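/- An alphabet is a finite nonempty set. A (multi-valued partial) function $f$ maps $\Sigma^*$ to the power set $\mathcal P(\Gamma^*)$ for some alphabets $\Sigma,\Gamma$; it is single-valued if $|f(x)|\le 1$ for all $x$. Consider one-way one-head nondeterministic pushdown automata (npda's) that allow $\lambda$-moves, read an input $x\in\Sigma^*$ enclosed in two endmarkers, are equipped with a write-only output tape over $\Gamma$ (at most one output symbol is written per step), and all of whose computation paths reach a halting (accepting or rejecting) state within $O(n)$ steps on inputs of length $n$. Let $\mathrm{CFLMV}$ be the class of all functions $f:\Sigma^*\to\mathcal P(\Gamma^*)$ for which there is such an npda $N$ such that, for every $x\in\Sigma^*$, $f(x)$ is the set of all strings produced on the output tape along accepting computation paths of $N$ on $x$. Let $\mathrm{CFLSV}$ be the class of all single-valued functions in $\mathrm{CFLMV}$. For classes $\mathcal F,\mathcal G$ of functions, let $\mathcal F\wedge\mathcal G$ (resp. $\mathcal F\vee\mathcal G$) be the class of all functions $x\mapsto f(x)\cap g(x)$ (resp. $x\mapsto f(x)\cup g(x)$) with $f\in\mathcal F$ and $g\in\mathcal G$ over common alphabets. Put $\mathrm{CFLMV}(1)=\mathrm{CFLMV}$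 and $\mathrm{CFLMV}(k+1)=\mathrm{CFLMV}(k)\wedge\mathrm{CFLMV}$, and define $\mathrm{CFLSV}(k)$ in the same way from $\mathrm{CFLSV}$. **Proposition.** Let $k,m\ge 1$. 1. $\mathrm{CFLMV}(\max\{k,m\})\subseteq \mathrm{CFLMV}(k)\vee\mathrm{CFLMV}(m)\subseteq\mathrm{CFLMV}(km)$. 2. $\mathrm{CFLMV}(\max\{k,m\})\subseteq \mathrm{CFLMV}(k)\wedge\mathrm{CFLMV}(m)\subseteq\mathrm{CFLMV}(k+m)$. 3. $\mathrm{CFLSV}(k)\subsetneq\mathrm{CFLSV}(k+1)$. -/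

import Mathlib

/-- The symbols that can occur on an input tape over the alphabet `A`: the left endmarker, the
letters of `A`, and the right endmarker. -/
inductive TapeSym (A : Type) : Type
  | left : TapeSym A
  | letter : A → TapeSym A
  | right : TapeSym A

/-- A one-way one-head nondeterministic pushdown automaton with lambda-moves and with a write-only
output tape; `A` is the input alphabet and `B` the output alphabet.  A transition depends on the
inner state, on the input symbol read (`none` for a lambda-move) and on the top stack symbol; it
gives the new state, the string that replaces the top stack symbol (its first letter becomes the
new top), and the symbol written on the output tape (`none` if nothing is written).
The transition function is used only at states that are not halting. -/
structure NPDA (A B : Type) where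
  Q : Type
  stackSym : Type
  finite_Q : Finite Q
  finite_stackSym : Finite stackSym
  δ : Q → Option (TapeSym A) → stackSym → Finset (Q × List stackSym × Option B)
  q₀ : Q
  Z₀ : stackSym
  acc : Set Q
  rej : Set Q
  disjoint_acc_rej : Disjoint acc rej

namespace NPDA

variable {A B : Type}

/-- A configuration: inner state, unread part of the input tape, stack (top first), and the string
written so far on the output tape. -/
structure Config (M : NPDA A B) where
  state : M.Q
  input : List (TapeSym A)
  stack : List M.stackSym
  output : List B

/-- The set of halting states. -/
def halt (M : NPDA A B) : Set M.Q := M.acc ∪ M.rej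

/-- The initial configuration on `x`: the input tape holds `x` between the two endmarkers. -/
def init (M : NPDA A B) (x : List A) : M.Config :=
  ⟨M.q₀, TapeSym.left :: (x.map TapeSym.letter ++ [TapeSym.right]), [M.Z₀], []⟩

/-- One step of the machine. -/
inductive Step (M : NPDA A B) : M.Config → M.Config → Prop
  | read {q q' : M.Q} {a : TapeSym A} {w : List (TapeSym A)} {Z : M.stackSym}
      {s u : List M.stackSym} {o : List B} {b : Option B}
      (hq : q ∉ M.halt) (h : (q', u, b) ∈ M.δ q (some a) Z) :
      Step M ⟨q, a :: w, Z :: s, o⟩ ⟨q', w, u ++ s, o ++ b.toList⟩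
  | lam {q q' : M.Q} {w : List (TapeSym A)} {Z : M.stackSym}
      {s u : List M.stackSym} {o : List B} {b : Option B}
      (hq : q ∉ M.halt) (h : (q', u, b) ∈ M.δ q none Z) :
      Step M ⟨q, w, Z :: s, o⟩ ⟨q', w, u ++ s, o ++ b.toList⟩

/-- `M.StepsIn t c d`: some computation path leads from `c` to `d` in exactly `t` steps. -/
inductive StepsIn (M : NPDA A B) : ℕ → M.Config → M.Config → Prop
  | refl (c : M.Config) : StepsIn M 0 c c
  | tail {t : ℕ} {c d e : M.Config} (h : StepsIn M t c d) (hs : M.Step d e) :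
      StepsIn M (t + 1) c e

/-- The termination condition: on every input of length `n`, all computation paths reach a halting
state, and they do so within `O(n)` steps. -/
def Terminating (M : NPDA A B) : Prop :=
  ∃ C : ℕ, ∀ (x : List A) (t : ℕ) (d : M.Config), M.StepsIn t (M.init x) d →
    t ≤ C * (x.length + 1) ∧ ((∀ e, ¬ M.Step d e) → d.state ∈ M.halt)

/-- The set of valid outputs of `M` on `x`, i.e. those produced along an accepting path. -/
def validOutputs (M : NPDA A B) (x : List A) : Set (List B) :=
  {y | ∃ (t : ℕ) (d : M.Config), M.StepsIn t (M.init x) d ∧ d.state ∈ M.acc ∧ d.output = y}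

end NPDA

/-- A class of multi-valued partial functions: for each input alphabet `A` and each output
alphabet `B` (finite nonempty types) a set of functions from strings over `A` to sets of strings
over `B`. -/
def FunClass : Type 1 :=
  ∀ (A B : Type) [Finite A] [Nonempty A] [Finite B] [Nonempty B], Set (List A → Set (List B))

namespace FunClass

/-- Containment of classes: every function of `F`, over whatever alphabets, belongs to `G`. -/
instance : HasSubset FunClass where
  Subset F G := ∀ (A B : Type) [Finite A] [Nonempty A] [Finite B] [Nonempty B]
    (f : List A → Set (List B)), f ∈ F A B → f ∈ G A B

/-- Proper containment: containment, and some function of `G`, over some alphabets, is not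
in `F`. -/
instance : HasSSubset FunClass where
  SSubset F G := F ⊆ G ∧
    ∃ (A B : Type) (_ : Finite A) (_ : Nonempty A) (_ : Finite B) (_ : Nonempty B)
      (f : List A → Set (List B)), f ∈ G A B ∧ f ∉ F A B

/-- The class of all `x ↦ f₁ x ∩ f₂ x` with `f₁ ∈ F` and `f₂ ∈ G`. -/
def wedge (F G : FunClass) : FunClass := fun A B _ _ _ _ =>
  {f | ∃ f₁ ∈ F A B, ∃ f₂ ∈ G A B, ∀ x, f x = f₁ x ∩ f₂ x}

/-- The class of all `x ↦ f₁ x ∪ f₂ x` with `f₁ ∈ F` and `f₂ ∈ G`. -/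
def vee (F G : FunClass) : FunClass := fun A B _ _ _ _ =>
  {f | ∃ f₁ ∈ F A B, ∃ f₂ ∈ G A B, ∀ x, f x = f₁ x ∪ f₂ x}

/-- The `k`-conjunctive class `F(k)` for `k ≥ 1`: `F(1) = F` and `F(k+1) = F(k) ∧ F`.
(The value at `0` is not used.) -/
def conj (F : FunClass) : ℕ → FunClass
  | 0 => F
  | 1 => F
  | k + 2 => (conj F (k + 1)).wedge F

end FunClass

/-- The functions computed by terminating npda's with output tapes. -/
def baseCFLMV : FunClass := fun A B _ _ _ _ =>
  {f | ∃ M : NPDA A B, M.Terminating ∧ ∀ x, f x = M.validOutputs x}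

/-- The single-valued (partial) functions among them. -/
def baseCFLSV : FunClass := fun A B _ _ _ _ =>
  {f | f ∈ baseCFLMV A B ∧ ∀ x, (f x).Subsingleton}

/-- The `k`-conjunctive class of multi-valued CFL functions. -/
def CFLMV (k : ℕ) : FunClass := baseCFLMV.conj k

/-- The `k`-conjunctive class of single-valued CFL functions. -/
def CFLSV (k : ℕ) : FunClass := baseCFLSV.conj k

/-!
Parts 1 and 2 are lattice identities once `CFLMV` is known to be closed under finite unions, which
holds because an automaton can begin by guessing which of finitely many automata to simulate.

In part 3 the levels are separated by the words over `m = k + 1` pairs of letters in which the two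
letters of each pair occur equally often: `m` automata decide this together, each using its stack
as a counter for one pair. For the lower bound let the inputs be sorted words
`a₁ ^ v₁ ⋯ a₂ₘ ^ v₂ₘ`, coded by `v`, with the first letters of all pairs before the second letters.
The vectors accepted by one automaton form a finite union of linear sets, by Parikh's theorem for
the triple construction. As pushes and pops are nested, the periods of these linear sets can be
taken stratified in the sense of Ginsburg and Spanier: every period has at most two nonzero
coordinates, and no two periods cross. The pairs of letters, on the other hand, all cross.

If the intersection over `k` automata consisted exactly of the diagonal vectors, then each automaton
would have one linear set containing almost all diagonal points over the moment curve, with respect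
to a fixed ultrafilter. Because its periods do not cross while the pairs of letters do, this set can
be moved along a hyperplane of directions that change the first half of the coordinates only. Since
`k < m`, the `k` hyperplanes share a nonzero direction, and moving along it leaves the diagonal
inside the intersection.
-/

/-! ### Parikh's theorem with stratified periods -/

open scoped Pointwise

/-- A binary context-free grammar up to commutation: a terminal rule replaces a nonterminal by a
vector of letter multiplicities. -/
structure VecGrammar (N ι : Type*) where
  leaf : N → (ι → ℕ) → Prop
  bin : N → N → N → Prop
  leaf_finite : ∀ X, {v | leaf X v}.Finite

namespace VecGrammar

variable {N ι α : Type*} {g : VecGrammar N ι}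

/-- `g.Derives X U v`: some derivation tree with root `X` has yield `v` and `U` as its set of
labels. -/
inductive Derives (g : VecGrammar N ι) : N → Set N → (ι → ℕ) → Prop
  | leaf {X : N} {v : ι → ℕ} (h : g.leaf X v) : Derives g X {X} v
  | node {X Y Z : N} {U V : Set N} {v w : ι → ℕ} (h : g.bin X Y Z) (hY : Derives g Y U v)
      (hZ : Derives g Z V w) : Derives g X (insert X (U ∪ V)) (v + w)

/-- `g.Ctx X Y p`: some derivation leads from `X` to a sentential form in which `Y` is surrounded
by terminals of total multiplicity `p`. -/
inductive Ctx (g : VecGrammar N ι) : N → N → (ι → ℕ) → Prop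
  | refl (X : N) : Ctx g X X 0
  | left {X Y Z T : N} {U : Set N} {p v : ι → ℕ} (h : g.bin X Y Z) (hZ : g.Derives Z U v)
      (hY : Ctx g Y T p) : Ctx g X T (p + v)
  | right {X Y Z T : N} {U : Set N} {p v : ι → ℕ} (h : g.bin X Y Z) (hY : g.Derives Y U v)
      (hZ : Ctx g Z T p) : Ctx g X T (p + v)

/-- The vectors that can be pumped at some nonterminal of `U`. -/
def loops (g : VecGrammar N ι) (U : Set N) : Set (ι → ℕ) := {p | ∃ X ∈ U, g.Ctx X X p}

theorem loops_mono {U V : Set N} (h : U ⊆ V) : g.loops U ⊆ g.loops V :=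
  fun _ ⟨X, hX, hp⟩ => ⟨X, h hX, hp⟩

theorem Derives.root_mem {X : N} {U : Set N} {v : ι → ℕ} (h : g.Derives X U v) : X ∈ U := by
  cases h <;> simp

theorem Ctx.plug {X Y : N} {U : Set N} {p v : ι → ℕ} (hc : g.Ctx X Y p) (hd : g.Derives Y U v) :
    ∃ V ⊇ U, g.Derives X V (v + p) := by
  induction hc with
  | refl X => exact ⟨U, subset_rfl, by simpa using hd⟩
  | left h hZ _ ih =>
    obtain ⟨V, hUV, hV⟩ := ih hd
    exact ⟨_, hUV.trans (Set.subset_union_left.trans (Set.subset_insert _ _)),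
      by simpa only [add_assoc] using hV.node h hZ⟩
  | right h hY _ ih =>
    obtain ⟨V, hUV, hV⟩ := ih hd
    exact ⟨_, hUV.trans (Set.subset_union_right.trans (Set.subset_insert _ _)),
      by simpa only [add_comm, add_left_comm] using hY.node h hV⟩

theorem Derives.add_ctx {X Y : N} {U : Set N} {p v : ι → ℕ} (hd : g.Derives X U v) (hY : Y ∈ U)
    (hc : g.Ctx Y Y p) : ∃ V ⊇ U, g.Derives X V (v + p) := by
  induction hd with
  | leaf h =>
    obtain rfl := Set.mem_singleton_iff.1 hY
    exact hc.plug (.leaf h)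
  | node h hV hW ihV ihW =>
    rcases hY with rfl | hY | hY
    · exact hc.plug (.node h hV hW)
    · obtain ⟨V', hVV', hV'⟩ := ihV hY
      exact ⟨_, Set.insert_subset_insert (Set.union_subset_union_left _ hVV'),
        by simpa only [add_right_comm] using hV'.node h hW⟩
    · obtain ⟨W', hWW', hW'⟩ := ihW hY
      exact ⟨_, Set.insert_subset_insert (Set.union_subset_union_right _ hWW'),
        by simpa only [add_assoc] using hV.node h hW'⟩

theorem Derives.add_mem_closure {X : N} {U : Set N} {p v : ι → ℕ} (hd : g.Derives X U v)
    (hp : p ∈ AddSubmonoid.closure (g.loops U)) : ∃ V ⊇ U, g.Derives X V (v + p) := by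
  induction hp using AddSubmonoid.closure_induction_right with
  | zero => exact ⟨U, subset_rfl, by simpa using hd⟩
  | add_right p _ q hq ih =>
    obtain ⟨V, hUV, hV⟩ := ih
    obtain ⟨Y, hY, hc⟩ := hq
    obtain ⟨W, hVW, hW⟩ := hV.add_ctx (hUV hY) hc
    exact ⟨W, hUV.trans hVW, by rwa [← add_assoc]⟩

/-- `g.Reduced F X U v` strengthens `g.Derives X U v`: attaching to each node the pair of its label
and the set of labels of its subtree, no pair of an inner node is in `F` or occurs again at an
inner node below it. -/
inductive Reduced (g : VecGrammar N ι) : Set (N × Set N) → N → Set N → (ι → ℕ) → Prop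
  | leaf {F : Set (N × Set N)} {X : N} {v : ι → ℕ} (h : g.leaf X v) : Reduced g F X {X} v
  | node {F : Set (N × Set N)} {X Y Z : N} {U V : Set N} {v w : ι → ℕ} (h : g.bin X Y Z)
      (hF : (X, insert X (U ∪ V)) ∉ F)
      (hY : Reduced g (insert (X, insert X (U ∪ V)) F) Y U v)
      (hZ : Reduced g (insert (X, insert X (U ∪ V)) F) Z V w) :
      Reduced g F X (insert X (U ∪ V)) (v + w)

namespace Reduced

theorem derives {F : Set (N × Set N)} {X : N} {U : Set N} {v : ι → ℕ} (h : g.Reduced F X U v) :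
    g.Derives X U v := by
  induction h with
  | leaf h => exact .leaf h
  | node h _ _ _ ihY ihZ => exact .node h ihY ihZ

theorem anti {F G : Set (N × Set N)} {X : N} {U : Set N} {v : ι → ℕ} (h : g.Reduced F X U v)
    (hGF : G ⊆ F) : g.Reduced G X U v := by
  induction h generalizing G with
  | leaf h => exact .leaf h
  | node h hF _ _ ihY ihZ =>
    exact .node h (fun hG => hF (hGF hG)) (ihY (Set.insert_subset_insert hGF))
      (ihZ (Set.insert_subset_insert hGF))

theorem insert_or_exists_ctx {F : Set (N × Set N)} {X : N} {U : Set N} {v : ι → ℕ}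
    (h : g.Reduced F X U v) (Y : N) (V : Set N) :
    g.Reduced (insert (Y, V) F) X U v ∨
      ∃ w p, g.Reduced F Y V w ∧ g.Ctx X Y p ∧ v = w + p := by
  induction h with
  | leaf h => exact .inl (.leaf h)
  | @node F X X₁ X₂ U₁ U₂ v₁ v₂ h hF h₁ h₂ ih₁ ih₂ =>
    by_cases heq : (X, insert X (U₁ ∪ U₂)) = (Y, V)
    · cases heq
      exact .inr ⟨_, 0, .node h hF h₁ h₂, .refl _, (add_zero _).symm⟩
    · rcases ih₁ with ih₁ | ⟨w, p, hw, hp, rfl⟩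
      · rcases ih₂ with ih₂ | ⟨w, p, hw, hp, rfl⟩
        · rw [Set.insert_comm] at ih₁ ih₂
          exact .inl (.node h (fun hm => hm.elim heq hF) ih₁ ih₂)
        · exact .inr ⟨w, p + v₁, hw.anti (Set.subset_insert _ _), .right h h₁.derives hp,
            by rw [add_comm, add_assoc]⟩
      · exact .inr ⟨w, p + v₂, hw.anti (Set.subset_insert _ _), .left h h₂.derives hp,
          add_assoc _ _ _⟩

theorem finite_setOf [Finite N] (F : Set (N × Set N)) (X : N) (U : Set N) :
    {v | g.Reduced F X U v}.Finite := by
  induction F using WellFoundedGT.induction generalizing X U with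
  | ind F ih =>
    by_cases hF : (X, U) ∈ F
    · refine (g.leaf_finite X).subset ?_
      rintro _ (h | ⟨-, hF', -, -⟩)
      exacts [h, absurd hF hF']
    · have ih := fun Y V => ih _ (Set.ssubset_insert hF) Y V
      refine ((g.leaf_finite X).union (Set.finite_iUnion fun k : (N × Set N) × (N × Set N) =>
        (ih k.1.1 k.1.2).add (ih k.2.1 k.2.2))).subset ?_
      rintro _ (h | ⟨-, -, hY, hZ⟩)
      · exact .inl h
      · exact .inr (Set.mem_iUnion.2 ⟨((_, _), (_, _)), Set.add_mem_add hY hZ⟩)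

end Reduced

/-- The loops at nonterminals of `U` that are small enough to occur in a tree whose two subtrees
at the root are reduced. -/
def smallLoops (g : VecGrammar N ι) (U : Set N) : Set (ι → ℕ) :=
  {p ∈ g.loops U | ∃ Y V v Z W w, g.Reduced ∅ Y V v ∧ g.Reduced ∅ Z W w ∧ p ≤ v + w}

theorem smallLoops_mono {U V : Set N} (h : U ⊆ V) : g.smallLoops U ⊆ g.smallLoops V :=
  fun _ ⟨hp, hle⟩ => ⟨loops_mono h hp, hle⟩

theorem finite_smallLoops [Finite N] [Finite ι] (U : Set N) : (g.smallLoops U).Finite := by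
  classical
  have := Fintype.ofFinite ι
  have reduced_finite : (⋃ k : N × Set N, {v | g.Reduced ∅ k.1 k.2 v}).Finite :=
    Set.finite_iUnion fun k => Reduced.finite_setOf ∅ k.1 k.2
  refine ((reduced_finite.add reduced_finite).biUnion fun b _ => Set.finite_Iic b).subset ?_
  rintro p ⟨-, Y, V, v, Z, W, w, hv, hw, hp⟩
  exact Set.mem_biUnion (Set.add_mem_add (Set.mem_iUnion.2 ⟨(Y, V), hv⟩)
    (Set.mem_iUnion.2 ⟨(Z, W), hw⟩)) hp

/-- The label set is part of the keys of reduced trees because a loop may only be reinserted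
where its nonterminal still occurs after the cut. -/
theorem Derives.exists_reduced {X : N} {U : Set N} {v : ι → ℕ} (h : g.Derives X U v) :
    ∃ w, g.Reduced ∅ X U w ∧ ∃ p ∈ AddSubmonoid.closure (g.smallLoops U), v = w + p := by
  induction h with
  | leaf h => exact ⟨_, .leaf h, 0, zero_mem _, (add_zero _).symm⟩
  | @node X Y Z V W _ _ h _ _ ihY ihZ =>
    obtain ⟨v, hv, p, hp, rfl⟩ := ihY
    obtain ⟨w, hw, q, hq, rfl⟩ := ihZ
    have hpq : p + q ∈ AddSubmonoid.closure (g.smallLoops (insert X (V ∪ W))) :=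
      add_mem
        (AddSubmonoid.closure_mono
          (smallLoops_mono (Set.subset_union_left.trans (Set.subset_insert _ _))) hp)
        (AddSubmonoid.closure_mono
          (smallLoops_mono (Set.subset_union_right.trans (Set.subset_insert _ _))) hq)
    have cut : ∀ u r, g.Reduced ∅ X (insert X (V ∪ W)) u → g.Ctx X X r → v + w = u + r →
        ∃ u, g.Reduced ∅ X (insert X (V ∪ W)) u ∧
          ∃ r ∈ AddSubmonoid.closure (g.smallLoops (insert X (V ∪ W))),
            v + p + (w + q) = u + r := by
      intro u r hu hr heq
      have hr' : r ∈ g.smallLoops (insert X (V ∪ W)) :=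
        ⟨⟨X, Set.mem_insert _ _, hr⟩, Y, V, v, Z, W, w, hv, hw, heq ▸ le_add_self⟩
      exact ⟨u, hu, r + (p + q), add_mem (AddSubmonoid.subset_closure hr') hpq,
        by rw [add_add_add_comm, heq, add_assoc]⟩
    rcases hv.insert_or_exists_ctx X (insert X (V ∪ W)) with hv' | ⟨u, r, hu, hr, rfl⟩
    · rcases hw.insert_or_exists_ctx X (insert X (V ∪ W)) with hw' | ⟨u, r, hu, hr, rfl⟩
      · exact ⟨v + w, .node h (Set.notMem_empty _) hv' hw', p + q, hpq,
          add_add_add_comm _ _ _ _⟩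
      · exact cut u (r + v) hu (.right h hv.derives hr) (by rw [add_comm, add_assoc])
    · exact cut u (r + w) hu (.left h hw.derives hr) (add_assoc _ _ _)

/-- For a finite automaton that reads the letters in increasing order, `lo` and `hi` are the states
in which it enters and leaves the word derived from a nonterminal, and `pos` is the state reached
by a letter. -/
structure Phases [Preorder α] (g : VecGrammar N ι) (pos : ι → α) (lo hi : N → α) : Prop where
  leaf : ∀ {X v}, g.leaf X v → lo X ≤ hi X ∧ ∀ i, v i ≠ 0 → lo X ≤ pos i ∧ pos i ≤ hi X
  bin : ∀ {X Y Z}, g.bin X Y Z → lo Y = lo X ∧ lo Z = hi Y ∧ hi Z = hi X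

end VecGrammar

/-- The relation joining two coordinates at which some vector of `P` is nonzero. -/
def SupportAdj {ι : Type*} (P : Set (ι → ℕ)) (x y : ι) : Prop := ∃ p ∈ P, p x ≠ 0 ∧ p y ≠ 0

/-- A relation on a line is noncrossing if, drawn as arcs above the line, it has no two
crossing arcs. -/
def IsNoncrossing {ι : Type*} [LT ι] (R : ι → ι → Prop) : Prop :=
  ∀ ⦃i j l r⦄, i < j → j < l → l < r → R i l → ¬ R j r

/-- A set of vectors is stratified if each of them has at most two nonzero coordinates and no two
of them cross. -/
structure IsStratified {ι : Type*} [LT ι] (P : Set (ι → ℕ)) : Prop where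
  support : ∀ p ∈ P, ∀ i j l, p i ≠ 0 → p j ≠ 0 → p l ≠ 0 → i = j ∨ j = l ∨ i = l
  isNoncrossing : IsNoncrossing (SupportAdj P)

theorem SupportAdj.mono {ι : Type*} {P Q : Set (ι → ℕ)} (h : P ⊆ Q) {x y : ι} :
    SupportAdj P x y → SupportAdj Q x y := fun ⟨p, hp, hxy⟩ => ⟨p, h hp, hxy⟩

theorem IsStratified.mono {ι : Type*} [LT ι] {P Q : Set (ι → ℕ)} (hQ : IsStratified Q)
    (h : P ⊆ Q) : IsStratified P :=
  ⟨fun p hp => hQ.support p (h hp), fun _ _ _ _ hij hjl hlr hil hjr =>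
    hQ.isNoncrossing hij hjl hlr (hil.mono h) (hjr.mono h)⟩

/-- A linear set with a stratified set of periods. -/
def IsStratifiedLinearSet {ι : Type*} [LT ι] (S : Set (ι → ℕ)) : Prop :=
  ∃ (b : ι → ℕ) (P : Set (ι → ℕ)), P.Finite ∧ IsStratified P ∧
    S = b +ᵥ (AddSubmonoid.closure P : Set (ι → ℕ))

/-- A finite union of stratified linear sets. -/
def IsStratifiedSemilinearSet {ι : Type*} [LT ι] (S : Set (ι → ℕ)) : Prop :=
  ∃ 𝓛 : Set (Set (ι → ℕ)), 𝓛.Finite ∧ (∀ L ∈ 𝓛, IsStratifiedLinearSet L) ∧ S = ⋃₀ 𝓛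

namespace VecGrammar.Phases

variable {N ι α : Type*} [LinearOrder α] {g : VecGrammar N ι} {pos : ι → α} {lo hi : N → α}

theorem label_bounds (hg : g.Phases pos lo hi) {X : N} {U : Set N} {v : ι → ℕ}
    (h : g.Derives X U v) : ∀ Y ∈ U, lo X ≤ lo Y ∧ lo Y ≤ hi Y ∧ hi Y ≤ hi X := by
  induction h with
  | leaf h =>
    rintro Y rfl
    exact ⟨le_rfl, (hg.leaf h).1, le_rfl⟩
  | node h hY hZ ihY ihZ =>
    have hbin := hg.bin h
    have hroot := And.intro (ihY _ hY.root_mem) (ihZ _ hZ.root_mem)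
    rintro T (rfl | hT | hT)
    · grind
    · grind
    · grind

theorem yield_bounds (hg : g.Phases pos lo hi) {X : N} {U : Set N} {v : ι → ℕ}
    (h : g.Derives X U v) {i : ι} (hi' : v i ≠ 0) : lo X ≤ pos i ∧ pos i ≤ hi X := by
  induction h with
  | leaf h => exact (hg.leaf h).2 i hi'
  | @node X Y Z U V v w h hY hZ ihY ihZ =>
    have hbin := hg.bin h
    have hrootY := hg.label_bounds hY _ hY.root_mem
    have hrootZ := hg.label_bounds hZ _ hZ.root_mem
    grind [Pi.add_apply]

theorem label_not_cross (hg : g.Phases pos lo hi) {X : N} {U : Set N} {v : ι → ℕ}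
    (h : g.Derives X U v) :
    ∀ Y ∈ U, ∀ Z ∈ U, ¬ (lo Y < lo Z ∧ lo Z < hi Y ∧ hi Y < hi Z) := by
  induction h with
  | leaf h =>
    rintro Y rfl Z rfl
    exact fun h => lt_irrefl _ h.1
  | node h hY hZ ihY ihZ =>
    have hbin := hg.bin h
    have boundsY := hg.label_bounds hY
    have boundsZ := hg.label_bounds hZ
    have hroot := And.intro (boundsY _ hY.root_mem) (boundsZ _ hZ.root_mem)
    rintro S (rfl | hS | hS) T (rfl | hT | hT) <;> grind

theorem ctx_bounds (hg : g.Phases pos lo hi) {X Y : N} {p : ι → ℕ} (h : g.Ctx X Y p)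
    (hY : lo Y ≤ hi Y) : lo X ≤ lo Y ∧ hi Y ≤ hi X ∧ ∀ i, p i ≠ 0 →
      (lo X ≤ pos i ∧ pos i ≤ lo Y) ∨ (hi Y ≤ pos i ∧ pos i ≤ hi X) := by
  induction h with
  | refl X => simp
  | left h hd _ ih | right h hd _ ih =>
    specialize ih hY
    have hbin := hg.bin h
    have hroot := hg.label_bounds hd _ hd.root_mem
    have hyield := fun i => hg.yield_bounds hd (i := i)
    refine ⟨by grind, by grind, fun i hpi => ?_⟩
    grind [Pi.add_apply]

theorem isStratified_loops [LinearOrder ι] (hg : g.Phases pos lo hi) (hpos : StrictMono pos)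
    {X : N} {U : Set N} {v : ι → ℕ} (h : g.Derives X U v) : IsStratified (g.loops U) := by
  have support_subset : ∀ p ∈ g.loops U, ∃ Y ∈ U, lo Y ≤ hi Y ∧
      ∀ i, p i ≠ 0 → pos i = lo Y ∨ pos i = hi Y := by
    rintro p ⟨Y, hY, hc⟩
    have hle := (hg.label_bounds h Y hY).2.1
    refine ⟨Y, hY, hle, fun i hpi => ?_⟩
    have := (hg.ctx_bounds hc hle).2.2 i hpi
    grind
  constructor
  · intro p hp i j l hpi hpj hpl
    obtain ⟨Y, -, -, hs⟩ := support_subset p hp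
    have := hs i hpi
    have := hs j hpj
    have := hs l hpl
    simp only [← hpos.injective.eq_iff]
    grind
  · rintro i j l r hij hjl hlr ⟨p, hp, hpi, hpl⟩ ⟨q, hq, hqj, hqr⟩
    obtain ⟨Y, hY, hYle, hs⟩ := support_subset p hp
    obtain ⟨Z, hZ, hZle, hs'⟩ := support_subset q hq
    have := hs i hpi
    have := hs l hpl
    have := hs' j hqj
    have := hs' r hqr
    have := hpos hij
    have := hpos hjl
    have := hpos hlr
    have := hg.label_not_cross h Y hY Z hZ
    grind

/-- Parikh's theorem; the order of the phases makes the periods stratified. -/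
theorem isStratifiedSemilinearSet [Finite N] [Finite ι] [LinearOrder ι]
    (hg : g.Phases pos lo hi) (hpos : StrictMono pos) (X : N) :
    IsStratifiedSemilinearSet {v | ∃ U, g.Derives X U v} := by
  refine ⟨⋃ U, (fun w => w +ᵥ (AddSubmonoid.closure (g.smallLoops U) : Set (ι → ℕ))) ''
    {w | g.Reduced ∅ X U w}, Set.finite_iUnion fun U => (Reduced.finite_setOf ∅ X U).image _,
    ?_, Set.ext fun v => ⟨?_, ?_⟩⟩
  · simp only [Set.mem_iUnion]
    rintro _ ⟨U, w, hw, rfl⟩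
    exact ⟨w, _, finite_smallLoops U,
      (hg.isStratified_loops hpos hw.derives).mono fun _ h => h.1, rfl⟩
  · rintro ⟨U, hd⟩
    obtain ⟨w, hw, p, hp, rfl⟩ := hd.exists_reduced
    exact ⟨_, Set.mem_iUnion.2 ⟨U, w, hw, rfl⟩, p, hp, rfl⟩
  · rintro ⟨_, hL, hv⟩
    obtain ⟨U, w, hw, rfl⟩ := Set.mem_iUnion.1 hL
    obtain ⟨p, hp, rfl⟩ := hv
    have hp : p ∈ AddSubmonoid.closure (g.loops U) :=
      AddSubmonoid.closure_mono (fun _ h => h.1) hp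
    obtain ⟨V, -, hV⟩ := hw.derives.add_mem_closure hp
    exact ⟨V, hV⟩

end VecGrammar.Phases

/-! ### Noncrossing relations and the diagonal -/

theorem mem_uIoo_iff_mem_uIoo_of_ne {ι : Type*} [LinearOrder ι] {a b c d : ι} (hac : a ≠ c)
    (had : a ≠ d) (hbc : b ≠ c) (hbd : b ≠ d) (h : a ∈ Set.uIoo c d ↔ b ∈ Set.uIoo c d) :
    c ∈ Set.uIoo a b ↔ d ∈ Set.uIoo a b := by
  rcases le_total a b with hab | hab <;> rcases le_total c d with hcd | hcd <;>
    simp only [hab, hcd, Set.uIoo_of_le, Set.uIoo_of_ge, Set.mem_Ioo] at h ⊢ <;>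
    grind

namespace IsNoncrossing

open Relation

variable {ι : Type*} [LinearOrder ι] {R : ι → ι → Prop} [Std.Symm R]

theorem mem_uIoo_iff_of_rel (hR : IsNoncrossing R) {l l' x y : ι} (hl : R l l') (hxy : R x y)
    (hlx : l ≠ x) (hly : l ≠ y) (hlx' : l' ≠ x) (hly' : l' ≠ y) :
    x ∈ Set.uIoo l l' ↔ y ∈ Set.uIoo l l' := by
  have hl' := symm_of R hl
  have hyx := symm_of R hxy
  rcases le_total l l' with h | h <;> rcases le_total x y with h' | h' <;>
    simp only [h, Set.uIoo_of_le, Set.uIoo_of_ge, Set.mem_Ioo] <;>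
    grind [IsNoncrossing]

theorem mem_uIoo_iff_of_reflTransGen (hR : IsNoncrossing R) {l l' x y : ι} (hl : R l l')
    (hxy : ReflTransGen R x y) (hlx : ¬ ReflTransGen R l x) :
    x ∈ Set.uIoo l l' ↔ y ∈ Set.uIoo l l' := by
  have ne : ∀ z, ReflTransGen R x z → l ≠ z ∧ l' ≠ z := fun z hz =>
    ⟨fun h => hlx (h ▸ symm_of _ hz), fun h => hlx ((ReflTransGen.single hl).trans
      (h ▸ symm_of _ hz))⟩
  induction hxy with
  | refl => rfl
  | tail hxy hyz ih =>
    exact ih.trans (hR.mem_uIoo_iff_of_rel hl hyz (ne _ hxy).1 (ne _ (hxy.tail hyz)).1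
      (ne _ hxy).2 (ne _ (hxy.tail hyz)).2)

theorem reflTransGen_mem_uIoo_iff (hR : IsNoncrossing R) {l l' x y : ι}
    (hl : ReflTransGen R l l') (hxy : ReflTransGen R x y) (hlx : ¬ ReflTransGen R l x) :
    l ∈ Set.uIoo x y ↔ l' ∈ Set.uIoo x y := by
  induction hl with
  | refl => rfl
  | @tail l' l'' hl hl' ih =>
    have ne : ∀ a, ReflTransGen R l a → ∀ z, ReflTransGen R x z → z ≠ a := fun a ha z hz h =>
      hlx (ha.trans (h ▸ symm_of _ hz))
    have hxl' : ¬ ReflTransGen R l' x := fun h => hlx (hl.trans h)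
    exact ih.trans (mem_uIoo_iff_mem_uIoo_of_ne (ne _ hl _ .refl) (ne _ (hl.tail hl') _ .refl)
      (ne _ hl _ hxy) (ne _ (hl.tail hl') _ hxy) (hR.mem_uIoo_iff_of_reflTransGen hl' hxy hxl'))

theorem reflTransGen_of_cross (hR : IsNoncrossing R) {p q r s : ι} (hpq : p < q) (hqr : q < r)
    (hrs : r < s) (hpr : ReflTransGen R p r) (hqs : ReflTransGen R q s) :
    ReflTransGen R p q := by
  by_contra h
  have := hR.reflTransGen_mem_uIoo_iff hpr hqs h
  simp only [Set.uIoo_of_lt (hqr.trans hrs), Set.mem_Ioo] at this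
  exact hpq.not_gt (this.2 ⟨hqr, hrs⟩).1

end IsNoncrossing

instance SupportAdj.instSymm {ι : Type*} (P : Set (ι → ℕ)) : Std.Symm (SupportAdj P) where
  symm := fun _ _ ⟨p, hp, hx, hy⟩ => ⟨p, hp, hy, hx⟩

section Orthogonal

variable {ι : Type*}

/-- The coordinatewise cast of natural vectors to rational vectors. -/
def castVec : (ι → ℕ) →+ (ι → ℚ) := (Nat.castAddMonoidHom ℚ).compLeft ι

@[simp]
theorem castVec_apply (v : ι → ℕ) (i : ι) : castVec v i = v i := rfl

theorem castVec_injective : Function.Injective (castVec : (ι → ℕ) → ι → ℚ) := fun v w h =>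
  funext fun i => by simpa using congrFun h i

variable [Fintype ι]

/-- The rational vectors orthogonal to all vectors of `P`. -/
def orth (P : Set (ι → ℕ)) : Submodule ℚ (ι → ℚ) where
  carrier := {φ | ∀ p ∈ P, φ ⬝ᵥ castVec p = 0}
  add_mem' hφ hψ p hp := by rw [add_dotProduct, hφ p hp, hψ p hp, add_zero]
  zero_mem' p _ := zero_dotProduct _
  smul_mem' c φ hφ p hp := by rw [smul_dotProduct, hφ p hp, smul_zero]

theorem mem_span_castVec_of_orth {P : Set (ι → ℕ)} {w : ι → ℚ}
    (hw : ∀ φ ∈ orth P, φ ⬝ᵥ w = 0) : w ∈ Submodule.span ℚ (castVec '' P) := by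
  classical
  by_contra hn
  obtain ⟨f, hfw, hle⟩ := Submodule.exists_le_ker_of_notMem hn
  obtain ⟨φ, rfl⟩ := (dotProductEquiv ℚ ι).surjective f
  exact hfw (hw φ fun p hp => hle (Submodule.subset_span ⟨p, hp, rfl⟩))

open Relation

open scoped Classical in
theorem restrict_mem_orth {P : Set (ι → ℕ)} {φ : ι → ℚ} (hφ : φ ∈ orth P) (x : ι) :
    (fun i => if ReflTransGen (SupportAdj P) x i then φ i else 0) ∈ orth P := by
  intro p hp
  by_cases h : ∃ s, ReflTransGen (SupportAdj P) x s ∧ p s ≠ 0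
  · obtain ⟨s, hs, hps⟩ := h
    refine Eq.trans (Finset.sum_congr rfl fun i _ => ?_) (hφ p hp)
    by_cases hpi : p i = 0
    · simp [hpi]
    · exact congrArg (· * _) (if_pos (hs.tail ⟨p, hp, hps, hpi⟩))
  · push Not at h
    refine Finset.sum_eq_zero fun i _ => ?_
    by_cases hi : ReflTransGen (SupportAdj P) x i
    · simp [h i hi]
    · simp [hi]

theorem IsStratified.ne_zero_of_reflTransGen [LT ι] {P : Set (ι → ℕ)} (hP : IsStratified P)
    {φ : ι → ℚ} (hφ : φ ∈ orth P) {x y : ι} (h : ReflTransGen (SupportAdj P) x y)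
    (hx : φ x ≠ 0) : φ y ≠ 0 := by
  induction h with
  | refl => exact hx
  | @tail x y _ h hx =>
    obtain ⟨p, hp, hpx, hpy⟩ := h
    by_cases hxy : x = y
    · rwa [← hxy]
    have hsum : φ x * p x + φ y * p y = 0 := by
      rw [← hφ p hp]
      refine (Finset.sum_eq_add (f := fun i => φ i * castVec p i) x y hxy (fun l _ hl => ?_)
        (by simp) (by simp)).symm
      have hpl : p l = 0 := by
        have := hP.support p hp x y l hpx hpy
        grind only
      simp [hpl]
    intro hy
    simp [hy, hx, hpx] at hsum

end Orthogonal

/-- The vectors whose two halves agree. -/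
def diagonal (m : ℕ) : Set (Fin (m + m) → ℕ) :=
  {v | ∀ i : Fin m, v (Fin.castAdd m i) = v (Fin.natAdd m i)}

namespace IsStratified

open Relation

variable {m : ℕ} {P : Set (Fin (m + m) → ℕ)}

theorem reflTransGen_castAdd_natAdd
    (hdiag : ∀ φ ∈ orth P, ∀ i : Fin m, φ (Fin.castAdd m i) + φ (Fin.natAdd m i) = 0)
    {φ : Fin (m + m) → ℚ} (hφ : φ ∈ orth P) {i : Fin m} (hi : φ (Fin.castAdd m i) ≠ 0) :
    ReflTransGen (SupportAdj P) (Fin.castAdd m i) (Fin.natAdd m i) := by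
  classical
  by_contra hl
  have := hdiag _ (restrict_mem_orth hφ (Fin.castAdd m i)) i
  rw [if_pos .refl, if_neg hl, add_zero] at this
  exact hi this

/-- The pairs joined to their copies cross one another, so they all lie in one component. -/
theorem reflTransGen_castAdd_castAdd (hP : IsStratified P)
    (hdiag : ∀ φ ∈ orth P, ∀ i : Fin m, φ (Fin.castAdd m i) + φ (Fin.natAdd m i) = 0)
    {φ ψ : Fin (m + m) → ℚ} (hφ : φ ∈ orth P) (hψ : ψ ∈ orth P) {i j : Fin m}
    (hi : φ (Fin.castAdd m i) ≠ 0) (hj : ψ (Fin.castAdd m j) ≠ 0) :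
    ReflTransGen (SupportAdj P) (Fin.castAdd m i) (Fin.castAdd m j) := by
  have linked_of_lt : ∀ {φ ψ : Fin (m + m) → ℚ} {i j : Fin m}, φ ∈ orth P → ψ ∈ orth P →
      φ (Fin.castAdd m i) ≠ 0 → ψ (Fin.castAdd m j) ≠ 0 → i < j →
      ReflTransGen (SupportAdj P) (Fin.castAdd m i) (Fin.castAdd m j) := by
    intro φ ψ i j hφ hψ hi hj hij
    exact hP.isNoncrossing.reflTransGen_of_cross (Fin.strictMono_castAdd m hij)
      (j.isLt.trans_le (Nat.le_add_right m i)) (Fin.strictMono_natAdd m hij)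
      (reflTransGen_castAdd_natAdd hdiag hφ hi) (reflTransGen_castAdd_natAdd hdiag hψ hj)
  rcases lt_trichotomy i j with hij | rfl | hij
  · exact linked_of_lt hφ hψ hi hj hij
  · exact .refl
  · exact symm_of _ (linked_of_lt hψ hφ hj hi hij)

theorem orth_le_span_singleton (hP : IsStratified P)
    (hdiag : ∀ φ ∈ orth P, ∀ i : Fin m, φ (Fin.castAdd m i) + φ (Fin.natAdd m i) = 0) :
    ∃ φ₀, orth P ≤ Submodule.span ℚ {φ₀} := by
  have exists_ne_zero : ∀ φ ∈ orth P, φ ≠ 0 → ∃ i : Fin m, φ (Fin.castAdd m i) ≠ 0 := by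
    intro φ hφ hne
    contrapose! hne
    funext x
    exact Fin.addCases hne (fun i => by simpa [hne i] using hdiag φ hφ i) x
  by_cases h0 : orth P = ⊥
  · exact ⟨0, h0.trans_le bot_le⟩
  obtain ⟨φ₀, hφ₀, hne⟩ := (Submodule.ne_bot_iff _).1 h0
  obtain ⟨i, hi⟩ := exists_ne_zero φ₀ hφ₀ hne
  refine ⟨φ₀, fun φ hφ => Submodule.mem_span_singleton.2
    ⟨φ (Fin.castAdd m i) / φ₀ (Fin.castAdd m i), ?_⟩⟩
  by_contra hsub
  have hψ : φ - (φ (Fin.castAdd m i) / φ₀ (Fin.castAdd m i)) • φ₀ ∈ orth P :=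
    sub_mem hφ (Submodule.smul_mem _ _ hφ₀)
  obtain ⟨j, hj⟩ := exists_ne_zero _ hψ (sub_ne_zero.2 (Ne.symm hsub))
  refine hP.ne_zero_of_reflTransGen hψ (hP.reflTransGen_castAdd_castAdd hdiag hψ hφ₀ hj hi) hj ?_
  simp [hi]

end IsStratified

/-! ### Linear sets along the moment curve -/

section MomentCurve

open Filter

/-- The moment curve in both halves of the space: it lies on the diagonal and has only finitely
many points in any hyperplane that does not contain the diagonal. -/
def momentPoint (m t : ℕ) : Fin (m + m) → ℕ :=
  Fin.append (fun i : Fin m => t ^ (i.val + 1)) (fun i : Fin m => t ^ (i.val + 1))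

theorem momentPoint_mem_diagonal (m t : ℕ) : momentPoint m t ∈ diagonal m := fun i => by
  simp [momentPoint, -Fin.natAdd_eq_addNat]

theorem finite_setOf_sum_mul_pow_eq {m : ℕ} {a : Fin m → ℚ} (ha : a ≠ 0) (c : ℚ) :
    {t : ℕ | ∑ i, a i * (t : ℚ) ^ (i.val + 1) = c}.Finite := by
  set p : Polynomial ℚ := ∑ i, Polynomial.C (a i) * Polynomial.X ^ (i.val + 1) - Polynomial.C c
    with hp
  obtain ⟨i, hi⟩ := Function.ne_iff.1 ha
  have hcoeff : p.coeff (i.val + 1) = a i := by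
    simp [hp, Polynomial.coeff_X_pow, Fin.val_inj, Polynomial.coeff_C_succ]
  have hne : p ≠ 0 := by
    intro h
    rw [h, Polynomial.coeff_zero] at hcoeff
    exact hi hcoeff.symm
  refine ((Polynomial.finite_setOfPred_isRoot hne).preimage
    (f := fun t : ℕ => (t : ℚ)) Nat.cast_injective.injOn).subset fun t ht => ?_
  simp only [Set.mem_ofPred_eq] at ht
  simp [hp, Polynomial.IsRoot, Polynomial.eval_finsetSum, ht]

theorem eventually_eq_or_tendsto_atTop {T : Type*} (U : Ultrafilter T) (c : T → ℕ) :
    (∃ k, ∀ᶠ t in U, c t = k) ∨ Tendsto c U atTop := by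
  by_cases h : ∀ n, ∀ᶠ t in U, n ≤ c t
  · exact .inr (tendsto_atTop.2 h)
  · push Not at h
    obtain ⟨n, hn⟩ := h
    have : ∀ᶠ t in U, ∃ k ∈ Set.Iio n, c t = k := hn.mono fun t ht => ⟨c t, ht, rfl⟩
    obtain ⟨k, -, hk⟩ := (Ultrafilter.eventually_exists_mem_iff (Set.finite_Iio n)).1 this
    exact .inl ⟨k, hk⟩

/-- The coefficients that stay bounded along the ultrafilter are absorbed into the base point. -/
theorem exists_eventually_eq_add_sum {M T : Type*} [AddCommMonoid M] (U : Ultrafilter T) {b : M}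
    {P : Finset M} {f : T → M}
    (h : ∀ᶠ t in U, f t ∈ b +ᵥ (AddSubmonoid.closure (P : Set M) : Set M)) :
    ∃ Q ⊆ P, ∃ b' ∈ b +ᵥ (AddSubmonoid.closure (P : Set M) : Set M), ∃ c : T → M → ℕ,
      (∀ p ∈ Q, Tendsto (c · p) U atTop) ∧ ∀ᶠ t in U, f t = b' + ∑ p ∈ Q, c t p • p := by
  classical
  have exists_coeff : ∀ t, ∃ c : M → ℕ,
      f t ∈ b +ᵥ (AddSubmonoid.closure (P : Set M) : Set M) → f t = b + ∑ p ∈ P, c p • p := by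
    intro t
    by_cases ht : f t ∈ b +ᵥ (AddSubmonoid.closure (P : Set M) : Set M)
    · obtain ⟨p, hp, hpt⟩ := ht
      obtain ⟨c, -, rfl⟩ := AddSubmonoid.mem_closure_finset.1 hp
      exact ⟨c, fun _ => hpt.symm⟩
    · exact ⟨0, fun h => absurd h ht⟩
  choose c hc using exists_coeff
  have bounded : ∀ p, ∃ k, ¬ Tendsto (c · p) U atTop → ∀ᶠ t in U, c t p = k := by
    intro p
    rcases eventually_eq_or_tendsto_atTop U (c · p) with ⟨k, hk⟩ | hp
    · exact ⟨k, fun _ => hk⟩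
    · exact ⟨0, fun h => absurd hp h⟩
  choose k hk using bounded
  refine ⟨P.filter fun p => Tendsto (c · p) U atTop, Finset.filter_subset _ _, _,
    ⟨∑ p ∈ P with ¬ Tendsto (c · p) U atTop, k p • p, sum_mem fun p hp =>
      nsmul_mem (AddSubmonoid.subset_closure (Finset.mem_filter.1 hp).1) _, rfl⟩, c,
    fun p hp => (Finset.mem_filter.1 hp).2, ?_⟩
  have hk : ∀ᶠ t in U, ∀ p ∈ P.filter fun p => ¬ Tendsto (c · p) U atTop, c t p = k p :=
    (eventually_all_finset _).2 fun p hp => hk p (Finset.mem_filter.1 hp).2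
  filter_upwards [h, hk] with t ht hkt
  have hsum : ∑ p ∈ P with ¬ Tendsto (c · p) U atTop, k p • p =
      ∑ p ∈ P with ¬ Tendsto (c · p) U atTop, c t p • p :=
    Finset.sum_congr rfl fun p hp => by rw [hkt p hp]
  rw [hc t ht, vadd_eq_add, hsum, add_assoc, Finset.sum_filter_not_add_sum_filter]

/-- `N` is a common denominator of the coefficients of `w`. -/
theorem exists_forall_dvd_eventually_castVec_eq {ι T : Type*} {l : Filter T} {Q : Finset (ι → ℕ)}
    {c : T → (ι → ℕ) → ℕ} (hc : ∀ p ∈ Q, Tendsto (c · p) l atTop) {w : ι → ℚ}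
    (hw : w ∈ Submodule.span ℚ (castVec '' (Q : Set (ι → ℕ)))) :
    ∃ N ≠ 0, ∀ n : ℕ, N ∣ n → ∀ᶠ t in l, ∃ z ∈ AddSubmonoid.closure (Q : Set (ι → ℕ)),
      castVec z = castVec (∑ p ∈ Q, c t p • p) + n • w := by
  obtain ⟨a, rfl⟩ := Submodule.mem_span_image_finset_iff_exists_fun' ℚ |>.1 hw
  refine ⟨∏ p ∈ Q, (a p).den, Finset.prod_ne_zero_iff.2 fun p _ => (a p).den_nz, fun n hn => ?_⟩
  have integral : ∀ p ∈ Q, ((n * a p).num : ℚ) = n * a p := by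
    intro p hp
    obtain ⟨k, rfl⟩ := (Finset.dvd_prod_of_mem (fun p => (a p).den) hp).trans hn
    have : (((a p).den * k : ℕ) : ℚ) * a p = ((k * (a p).num : ℤ) : ℚ) := by
      push_cast
      rw [mul_right_comm, Rat.den_mul_eq_num, mul_comm]
    rw [this, Rat.num_intCast]
  have large : ∀ᶠ t in l, ∀ p ∈ Q, (n * a p).num.natAbs ≤ c t p :=
    (eventually_all_finset Q).2 fun p hp => (hc p hp).eventually_ge_atTop _
  filter_upwards [large] with t ht
  refine ⟨∑ p ∈ Q, (c t p + (n * a p).num).toNat • p, sum_mem fun p hp =>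
    nsmul_mem (AddSubmonoid.subset_closure hp) _, ?_⟩
  rw [map_sum, map_sum, Finset.smul_sum, ← Finset.sum_add_distrib]
  refine Finset.sum_congr rfl fun p hp => ?_
  have hnonneg : 0 ≤ (c t p : ℤ) + (n * a p).num := by have := ht p hp; omega
  have hcoeff : ((c t p + (n * a p).num).toNat : ℚ) = c t p + n * a p := by
    rw [← integral p hp]
    exact_mod_cast Int.toNat_of_nonneg hnonneg
  ext i
  simp [hcoeff, add_mul, mul_assoc, mul_left_comm]

theorem orth_castAdd_add_natAdd_eq_zero {m : ℕ} {Q : Finset (Fin (m + m) → ℕ)}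
    {b : Fin (m + m) → ℕ} {c : ℕ → (Fin (m + m) → ℕ) → ℕ}
    (h : ∀ᶠ t in hyperfilter ℕ, momentPoint m t = b + ∑ p ∈ Q, c t p • p)
    {φ : Fin (m + m) → ℚ} (hφ : φ ∈ orth (Q : Set (Fin (m + m) → ℕ))) (i : Fin m) :
    φ (Fin.castAdd m i) + φ (Fin.natAdd m i) = 0 := by
  by_contra hne
  refine notMem_hyperfilter_of_finite (finite_setOf_sum_mul_pow_eq
    (a := fun i => φ (Fin.castAdd m i) + φ (Fin.natAdd m i)) (Function.ne_iff.2 ⟨i, hne⟩)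
    (φ ⬝ᵥ castVec b)) (h.mono fun t ht => ?_)
  have hperiods : φ ⬝ᵥ castVec (∑ p ∈ Q, c t p • p) = 0 := by
    rw [map_sum, dotProduct_sum]
    refine Finset.sum_eq_zero fun p hp => ?_
    rw [map_nsmul, dotProduct_smul, hφ p hp, smul_zero]
  calc ∑ i, (φ (Fin.castAdd m i) + φ (Fin.natAdd m i)) * (t : ℚ) ^ (i.val + 1)
      = φ ⬝ᵥ castVec (momentPoint m t) := by
        simp [dotProduct, Fin.sum_univ_add, momentPoint, add_mul, Finset.sum_add_distrib,
          -Fin.natAdd_eq_addNat]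
    _ = φ ⬝ᵥ castVec b := by rw [ht, map_add, dotProduct_add, hperiods, add_zero]

theorem IsStratifiedLinearSet.exists_forall_eventually_add_mem {m : ℕ} {L : Set (Fin (m + m) → ℕ)}
    (hL : IsStratifiedLinearSet L) (h : ∀ᶠ t in hyperfilter ℕ, momentPoint m t ∈ L) :
    ∃ φ : Fin m → ℚ, ∀ w, φ ⬝ᵥ w = 0 → ∃ N ≠ 0, ∀ n : ℕ, N ∣ n → ∀ᶠ t in hyperfilter ℕ,
      ∃ z ∈ L, castVec z = castVec (momentPoint m t) + n • Fin.append w 0 := by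
  obtain ⟨b, P, hfin, hP, rfl⟩ := hL
  lift P to Finset (Fin (m + m) → ℕ) using hfin
  obtain ⟨Q, hQP, _, ⟨r, hr, rfl⟩, c, hc, heq⟩ := exists_eventually_eq_add_sum _ h
  obtain ⟨φ₀, hφ₀⟩ := (hP.mono hQP).orth_le_span_singleton fun φ hφ i =>
    orth_castAdd_add_natAdd_eq_zero heq hφ i
  refine ⟨fun i => φ₀ (Fin.castAdd m i), fun w hw => ?_⟩
  have hspan : Fin.append w 0 ∈ Submodule.span ℚ (castVec '' (Q : Set (Fin (m + m) → ℕ))) := by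
    refine mem_span_castVec_of_orth fun φ hφ => ?_
    obtain ⟨a, rfl⟩ := Submodule.mem_span_singleton.1 (hφ₀ hφ)
    rw [smul_dotProduct]
    simpa [dotProduct, Fin.sum_univ_add, -Fin.natAdd_eq_addNat] using .inr hw
  obtain ⟨N, hN, hshift⟩ := exists_forall_dvd_eventually_castVec_eq hc hspan
  refine ⟨N, hN, fun n hn => ?_⟩
  filter_upwards [heq, hshift n hn] with t ht ⟨z, hz, hzt⟩
  refine ⟨b + (r + z), ⟨r + z, add_mem hr (AddSubmonoid.closure_mono hQP hz), rfl⟩, ?_⟩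
  rw [ht, vadd_eq_add, map_add, map_add, map_add, map_add, hzt]
  abel

theorem iInter_ne_diagonal {J : Type*} [Finite J] [Nonempty J] {m : ℕ} (hJ : Nat.card J < m)
    {V : J → Set (Fin (m + m) → ℕ)} (hV : ∀ j, IsStratifiedSemilinearSet (V j)) :
    ⋂ j, V j ≠ diagonal m := by
  intro heq
  have := Fintype.ofFinite J
  have exists_linear : ∀ j, ∃ L ⊆ V j, IsStratifiedLinearSet L ∧
      ∀ᶠ t in hyperfilter ℕ, momentPoint m t ∈ L := by
    intro j
    obtain ⟨𝓛, hfin, h𝓛, hj⟩ := hV j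
    have hcover : ∀ᶠ t in hyperfilter ℕ, ∃ L ∈ 𝓛, momentPoint m t ∈ L := .of_forall fun t => by
      have := Set.mem_iInter.1 (heq.ge (momentPoint_mem_diagonal m t)) j
      rwa [hj] at this
    obtain ⟨L, hL, ht⟩ := (Ultrafilter.eventually_exists_mem_iff hfin).1 hcover
    exact ⟨L, hj ▸ Set.subset_sUnion_of_mem hL, h𝓛 L hL, ht⟩
  choose L hLV hL hmem using exists_linear
  choose φ hφ using fun j => (hL j).exists_forall_eventually_add_mem (hmem j)
  obtain ⟨w, hw, hw0⟩ : ∃ w ∈ LinearMap.ker (Matrix.of φ).mulVecLin, w ≠ 0 :=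
    (Submodule.ne_bot_iff _).1 (LinearMap.ker_ne_bot_of_finrank_lt (by simpa using hJ))
  choose N hN hshift using fun j => hφ j w (congrFun (LinearMap.mem_ker.1 hw) j)
  obtain ⟨t, ht⟩ := (eventually_all.2 fun j =>
    hshift j (∏ l, N l) (Finset.dvd_prod_of_mem N (Finset.mem_univ j))).exists
  choose z hzL hz using ht
  let j₀ : J := Classical.arbitrary J
  have hdiag : z j₀ ∈ diagonal m := heq.le <| Set.mem_iInter.2 fun j =>
    castVec_injective ((hz j₀).trans (hz j).symm) ▸ hLV j (hzL j)
  refine hw0 (funext fun i => ?_)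
  have hfst := congrFun (hz j₀) (Fin.castAdd m i)
  have hsnd := congrFun (hz j₀) (Fin.natAdd m i)
  simp only [castVec_apply, hdiag i] at hfst hsnd
  simpa [hsnd, momentPoint, Finset.prod_eq_zero_iff, hN, -Fin.natAdd_eq_addNat] using hfst

end MomentCurve

/-! ### Grammars of pushdown automata -/

instance TapeSym.instFinite {A : Type} [Finite A] : Finite (TapeSym A) :=
  Finite.of_surjective (fun s : Option (Option A) => match s with
    | none => .left
    | some none => .right
    | some (some a) => .letter a) fun s => match s with
    | .left => ⟨none, rfl⟩
    | .right => ⟨some none, rfl⟩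
    | .letter a => ⟨some (some a), rfl⟩

/-- A binary context-free grammar whose terminal rules produce at most one letter. -/
structure WordGrammar (N T : Type*) where
  term : N → Option T → Prop
  bin : N → N → N → Prop

namespace WordGrammar

variable {N T ι S : Type*}

/-- `g.Generates X w`: the word `w` can be derived from the nonterminal `X`. -/
inductive Generates (g : WordGrammar N T) : N → List T → Prop
  | term {X : N} {a : Option T} (h : g.term X a) : Generates g X a.toList
  | bin {X Y Z : N} {w w' : List T} (h : g.bin X Y Z) (hY : Generates g Y w)
      (hZ : Generates g Z w') : Generates g X (w ++ w')

theorem Generates.nil {g : WordGrammar N T} {X : N} (h : g.term X none) : g.Generates X [] :=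
  .term h

/-- The Bar-Hillel construction: a nonterminal `(X, i, j)` derives the commutative images, with
respect to `weight`, of the words that `X` derives and that lead the automaton from `i` to `j`. -/
def inter [Finite T] (g : WordGrammar N T) (A : NFA T S) (weight : T → ι → ℕ) :
    VecGrammar (N × S × S) ι where
  leaf X v := ∃ a, g.term X.1 a ∧ X.2.2 ∈ A.evalFrom {X.2.1} a.toList ∧
    (a.toList.map weight).sum = v
  bin X Y Z := g.bin X.1 Y.1 Z.1 ∧ Y.2.1 = X.2.1 ∧ Z.2.1 = Y.2.2 ∧ Z.2.2 = X.2.2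
  leaf_finite _ := (Set.finite_range fun a : Option T => (a.toList.map weight).sum).subset
    fun _ ⟨a, _, _, h⟩ => ⟨a, h⟩

theorem exists_inter_derives_iff [Finite T] {g : WordGrammar N T} {A : NFA T S}
    {weight : T → ι → ℕ} {X : N} {i j : S} {v : ι → ℕ} :
    (∃ U, (g.inter A weight).Derives (X, i, j) U v) ↔
      ∃ w, g.Generates X w ∧ j ∈ A.evalFrom {i} w ∧ (w.map weight).sum = v := by
  constructor
  · rintro ⟨U, h⟩
    generalize hX : (X, i, j) = X' at h
    induction h generalizing X i j with
    | leaf h =>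
      subst hX
      obtain ⟨a, ha, hij, rfl⟩ := h
      exact ⟨_, .term ha, hij, rfl⟩
    | @node _ Y Z _ _ _ _ h _ _ ihY ihZ =>
      subst hX
      obtain ⟨Y, i', k⟩ := Y
      obtain ⟨Z, k', j'⟩ := Z
      obtain ⟨h, rfl, rfl, rfl⟩ := h
      obtain ⟨w, hw, hik, rfl⟩ := ihY rfl
      obtain ⟨w', hw', hkj, rfl⟩ := ihZ rfl
      refine ⟨w ++ w', .bin h hw hw', ?_, by simp⟩
      rw [NFA.evalFrom_append, NFA.mem_evalFrom_iff_exists]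
      exact ⟨_, hik, hkj⟩
  · rintro ⟨w, hw, hij, rfl⟩
    induction hw generalizing i j with
    | term h => exact ⟨_, .leaf ⟨_, h, hij, rfl⟩⟩
    | @bin X Y Z _ _ h _ _ ihY ihZ =>
      rw [NFA.evalFrom_append, NFA.mem_evalFrom_iff_exists] at hij
      obtain ⟨k, hik, hkj⟩ := hij
      obtain ⟨U, hU⟩ := ihY hik
      obtain ⟨V, hV⟩ := ihZ hkj
      rw [List.map_append, List.sum_append]
      have hbin : (g.inter A weight).bin (X, i, j) (Y, i, k) (Z, k, j) := ⟨h, rfl, rfl, rfl⟩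
      exact ⟨_, .node hbin hU hV⟩

end WordGrammar

namespace NPDA

variable {A B : Type} {M : NPDA A B}

theorem exists_stepsIn_iff {c d : M.Config} :
    (∃ t, M.StepsIn t c d) ↔ Relation.ReflTransGen M.Step c d := by
  constructor
  · rintro ⟨t, h⟩
    induction h with
    | refl => exact .refl
    | tail _ h ih => exact .tail ih h
  · intro h
    induction h with
    | refl => exact ⟨0, .refl _⟩
    | tail _ h ih =>
      obtain ⟨t, ht⟩ := ih
      exact ⟨t + 1, .tail ht h⟩

/-- The string on the input tape when the input is `x`. -/
def tape (x : List A) : List (TapeSym A) :=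
  TapeSym.left :: (x.map TapeSym.letter ++ [TapeSym.right])

/-- `M.SilentlyAccepts o w s`: from the state `o`, the remaining input `w` and the stack `s`, some
accepting computation of `M` produces no output; the state `none` stands for having accepted. -/
def SilentlyAccepts (M : NPDA A B) : Option M.Q → List (TapeSym A) → List M.stackSym → Prop
  | none, _, _ => True
  | some q, w, s => ∃ d, Relation.ReflTransGen M.Step ⟨q, w, s, []⟩ d ∧ d.state ∈ M.acc ∧
      d.output = []

theorem nil_mem_validOutputs_iff_silentlyAccepts {x : List A} :
    [] ∈ M.validOutputs x ↔ M.SilentlyAccepts (some M.q₀) (tape x) [M.Z₀] := by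
  simp only [SilentlyAccepts, ← exists_stepsIn_iff]
  exact ⟨fun ⟨t, d, h, hd⟩ => ⟨d, ⟨t, h⟩, hd⟩, fun ⟨d, ⟨t, h⟩, hd⟩ => ⟨t, d, h, hd⟩⟩

/-- `M.Pops o s w r`: reading `w` without producing output, `M` gets from the state `o` to the
state `r` and removes the string `s` from the stack; the state `none` stands for having accepted,
from where everything is read and removed. -/
inductive Pops (M : NPDA A B) :
    Option M.Q → List M.stackSym → List (TapeSym A) → Option M.Q → Prop
  | nil (o : Option M.Q) : Pops M o [] [] o
  | cons {o p r : Option M.Q} {Z : M.stackSym} {s : List M.stackSym} {w w' : List (TapeSym A)}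
      (h : Pops M o [Z] w p) (h' : Pops M p s w' r) : Pops M o (Z :: s) (w ++ w') r
  | step {q q' : M.Q} {a : Option (TapeSym A)} {Z : M.stackSym} {u : List M.stackSym}
      {w : List (TapeSym A)} {r : Option M.Q} (hq : q ∉ M.halt) (h : (q', u, none) ∈ M.δ q a Z)
      (h' : Pops M (some q') u w r) : Pops M (some q) [Z] (a.toList ++ w) r
  | acc {q : M.Q} (hq : q ∈ M.acc) (s : List M.stackSym) (w : List (TapeSym A)) :
      Pops M (some q) s w none
  | accepted (s : List M.stackSym) (w : List (TapeSym A)) : Pops M none s w none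

namespace Pops

theorem silentlyAccepts_append {o r : Option M.Q} {s : List M.stackSym} {w : List (TapeSym A)}
    (h : M.Pops o s w r) {v : List (TapeSym A)} {st : List M.stackSym}
    (hr : M.SilentlyAccepts r v st) : M.SilentlyAccepts o (w ++ v) (s ++ st) := by
  induction h generalizing v st with
  | nil => exact hr
  | cons _ _ ih ih' => simpa using ih (ih' hr)
  | @step q q' a Z u w r hq h _ ih =>
    obtain ⟨d, hd, hacc⟩ := ih hr
    refine ⟨d, .head ?_ hd, hacc⟩
    cases a with
    | none => exact .lam hq h
    | some a => exact .read hq h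
  | acc hq => exact ⟨_, .refl, hq, rfl⟩
  | accepted => trivial

theorem cons_inv {o r : Option M.Q} {Z : M.stackSym} {s : List M.stackSym}
    {w : List (TapeSym A)} (h : M.Pops o (Z :: s) w r) :
    ∃ p w₁ w₂, w = w₁ ++ w₂ ∧ M.Pops o [Z] w₁ p ∧ M.Pops p s w₂ r := by
  cases h with
  | cons h h' => exact ⟨_, _, _, rfl, h, h'⟩
  | step hq h h' => exact ⟨_, _, _, (List.append_nil _).symm, .step hq h h', .nil _⟩
  | acc hq => exact ⟨none, w, [], (List.append_nil _).symm, .acc hq _ _, .accepted _ _⟩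
  | accepted => exact ⟨none, w, [], (List.append_nil _).symm, .accepted _ _, .accepted _ _⟩

theorem append_inv {u : List M.stackSym} {o r : Option M.Q} {s : List M.stackSym}
    {w : List (TapeSym A)} (h : M.Pops o (u ++ s) w r) :
    ∃ p w₁ w₂, w = w₁ ++ w₂ ∧ M.Pops o u w₁ p ∧ M.Pops p s w₂ r := by
  induction u generalizing o w with
  | nil => exact ⟨o, [], w, rfl, .nil o, h⟩
  | cons Z u ih =>
    obtain ⟨p, w₁, w₂, rfl, hZ, h⟩ := h.cons_inv
    obtain ⟨p', w₃, w₄, rfl, hu, hs⟩ := ih h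
    exact ⟨p', w₁ ++ w₃, w₄, (List.append_assoc _ _ _).symm, .cons hZ hu, hs⟩

theorem step_append {q q' : M.Q} {a : Option (TapeSym A)} {Z : M.stackSym}
    {u s : List M.stackSym} {w : List (TapeSym A)} {r : Option M.Q} (hq : q ∉ M.halt)
    (h : (q', u, none) ∈ M.δ q a Z) (h' : M.Pops (some q') (u ++ s) w r) :
    M.Pops (some q) (Z :: s) (a.toList ++ w) r := by
  obtain ⟨p, w₁, w₂, rfl, hu, hs⟩ := h'.append_inv
  rw [← List.append_assoc]
  exact .cons (.step hq h hu) hs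

theorem of_silentlyAccepts {q : M.Q} {w : List (TapeSym A)} {s : List M.stackSym}
    (h : M.SilentlyAccepts (some q) w s) : M.Pops (some q) s w none := by
  obtain ⟨d, hd, hacc, hout⟩ := h
  suffices key : ∀ c : M.Config, Relation.ReflTransGen M.Step c d →
      c.output = [] ∧ M.Pops (some c.state) c.stack c.input none from (key _ hd).2
  intro c hc
  induction hc using Relation.ReflTransGen.head_induction_on with
  | refl => exact ⟨hout, .acc hacc _ _⟩
  | head hs _ ih =>
    obtain ⟨hnil, hpops⟩ := ih
    cases hs with
    | read hq h | lam hq h =>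
      simp only [List.append_eq_nil_iff, Option.toList_eq_nil_iff] at hnil
      obtain ⟨rfl, rfl⟩ := hnil
      exact ⟨rfl, step_append hq h hpops⟩

end Pops

theorem nil_mem_validOutputs_iff_pops {x : List A} :
    [] ∈ M.validOutputs x ↔ M.Pops (some M.q₀) [M.Z₀] (tape x) none := by
  rw [nil_mem_validOutputs_iff_silentlyAccepts]
  refine ⟨Pops.of_silentlyAccepts, fun h => ?_⟩
  simpa using h.silentlyAccepts_append (v := []) (st := []) trivial

theorem exists_length_le [Finite A] (M : NPDA A B) :
    ∃ l ≠ 0, ∀ q a Z, ∀ e ∈ M.δ q a Z, e.2.1.length ≤ l := by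
  have := M.finite_Q
  have := M.finite_stackSym
  obtain ⟨l, hl⟩ := (Set.finite_range fun c : M.Q × Option (TapeSym A) × M.stackSym =>
    (M.δ c.1 c.2.1 c.2.2).sup fun e => e.2.1.length).bddAbove
  exact ⟨l + 1, l.succ_ne_zero, fun q a Z e he =>
    ((Finset.le_sup (f := fun e => e.2.1.length) he).trans (hl ⟨(q, a, Z), rfl⟩)).trans
      l.le_succ⟩

/-- The nonterminals of the grammar of `M`: one for all words (`inl none`), one for each word of
length at most one, and the triples of `NPDA.Pops` with stack strings of length at most `l`. -/
abbrev Nonterminal (M : NPDA A B) (l : ℕ) : Type :=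
  Option (Option (TapeSym A)) ⊕
    (Option M.Q × {s : List M.stackSym // s.length ≤ l} × Option M.Q)

/-- The terminal rules of the grammar of `M`. -/
inductive TermRule (M : NPDA A B) (l : ℕ) : M.Nonterminal l → Option (TapeSym A) → Prop
  | all : TermRule M l (.inl none) none
  | sym (a : Option (TapeSym A)) : TermRule M l (.inl (some a)) a
  | nil (o : Option M.Q) {s} (hs : s.1 = []) : TermRule M l (.inr (o, s, o)) none

/-- The binary rules of the grammar of `M`. -/
inductive BinRule (M : NPDA A B) (l : ℕ) :
    M.Nonterminal l → M.Nonterminal l → M.Nonterminal l → Prop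
  | all (a : TapeSym A) : BinRule M l (.inl none) (.inl (some (some a))) (.inl none)
  | cons {o p r : Option M.Q} {Z : M.stackSym} {s s₁ s₂} (h : s.1 = Z :: s₂.1) (h₁ : s₁.1 = [Z]) :
      BinRule M l (.inr (o, s, r)) (.inr (o, s₁, p)) (.inr (p, s₂, r))
  | step {q q' : M.Q} {a : Option (TapeSym A)} {Z : M.stackSym} {s u} {r : Option M.Q}
      (hs : s.1 = [Z]) (hq : q ∉ M.halt) (h : (q', u.1, none) ∈ M.δ q a Z) :
      BinRule M l (.inr (some q, s, r)) (.inl (some a)) (.inr (some q', u, r))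
  | acc {q : M.Q} {s} (hq : q ∈ M.acc) :
      BinRule M l (.inr (some q, s, none)) (.inl none) (.inl (some none))
  | accepted {s} : BinRule M l (.inr (none, s, none)) (.inl none) (.inl (some none))

/-- The triple construction: a grammar for the words on which `M` accepts silently. -/
def grammar (M : NPDA A B) (l : ℕ) : WordGrammar (M.Nonterminal l) (TapeSym A) where
  term := M.TermRule l
  bin := M.BinRule l

variable {l : ℕ}

/-- The words that a nonterminal of the grammar of `M` is meant to derive. -/
def Nonterminal.Lang : M.Nonterminal l → List (TapeSym A) → Prop
  | .inl none, _ => True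
  | .inl (some a), w => w = a.toList
  | .inr (o, s, r), w => M.Pops o s w r

theorem Nonterminal.lang_of_generates {X : M.Nonterminal l} {w : List (TapeSym A)}
    (h : (M.grammar l).Generates X w) : X.Lang w := by
  induction h with
  | term h =>
    cases h with
    | all => trivial
    | sym a => rfl
    | nil o hs => simpa only [Lang, hs, Option.toList_none] using Pops.nil o
  | bin h _ _ hY hZ =>
    cases h with
    | all => trivial
    | cons h h₁ =>
      simp only [Lang, h, h₁] at *
      exact .cons hY hZ
    | step hs hq h =>
      simp only [Lang, hs] at *
      subst hY
      exact .step hq h hZ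
    | acc hq => exact .acc hq _ _
    | accepted => exact .accepted _ _

theorem grammar_generates_all (w : List (TapeSym A)) :
    (M.grammar l).Generates (.inl none) w := by
  induction w with
  | nil => exact .nil TermRule.all
  | cons a w ih => exact .bin (BinRule.all a) (.term (TermRule.sym (some a))) ih

theorem Pops.generates (hl : ∀ q a Z, ∀ e ∈ M.δ q a Z, e.2.1.length ≤ l) {o r : Option M.Q}
    {s : List M.stackSym} {w : List (TapeSym A)} (h : M.Pops o s w r) (hs : s.length ≤ l) :
    (M.grammar l).Generates (.inr (o, ⟨s, hs⟩, r)) w := by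
  induction h with
  | nil o => exact .nil (TermRule.nil o rfl)
  | cons _ _ ih ih' =>
    simp only [List.length_cons] at hs
    exact .bin (BinRule.cons rfl rfl) (ih (by simp; omega)) (ih' (by omega))
  | step hq h _ ih =>
    exact .bin (BinRule.step rfl hq h) (.term (TermRule.sym _)) (ih (hl _ _ _ _ h))
  | acc hq s w =>
    rw [← List.append_nil w]
    exact .bin (BinRule.acc hq) (grammar_generates_all w) (.nil (TermRule.sym none))
  | accepted s w =>
    rw [← List.append_nil w]
    exact .bin BinRule.accepted (grammar_generates_all w) (.nil (TermRule.sym none))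

theorem exists_wordGrammar [Finite A] (M : NPDA A B) :
    ∃ (N : Type) (_ : Finite N) (g : WordGrammar N (TapeSym A)) (S : N),
      ∀ x, g.Generates S (tape x) ↔ [] ∈ M.validOutputs x := by
  have := M.finite_Q
  have := M.finite_stackSym
  obtain ⟨l, hl0, hl⟩ := M.exists_length_le
  have : Finite {s : List M.stackSym // s.length ≤ l} := List.finite_length_le _ _
  refine ⟨M.Nonterminal l, inferInstance, M.grammar l,
    .inr (some M.q₀, ⟨[M.Z₀], Nat.one_le_iff_ne_zero.2 hl0⟩, none), fun x => ?_⟩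
  rw [nil_mem_validOutputs_iff_pops]
  exact ⟨Nonterminal.lang_of_generates, fun h => h.generates hl _⟩

end NPDA

section SortedWord

variable {ι : Type*} [Fintype ι] [LinearOrder ι]

/-- The sorted word in which each letter `i` occurs `v i` times. -/
def sortedWord (v : ι → ℕ) : List ι := (∑ i, Multiset.replicate (v i) i).sort

theorem pairwise_sortedWord (v : ι → ℕ) : (sortedWord v).Pairwise (· ≤ ·) :=
  Multiset.pairwise_sort _ _

theorem count_sortedWord (v : ι → ℕ) (i : ι) : (sortedWord v).count i = v i := by
  rw [← Multiset.coe_count, sortedWord, Multiset.sort_eq, Multiset.count_sum']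
  simp [Multiset.count_replicate]

theorem eq_sortedWord {x : List ι} (hx : x.Pairwise (· ≤ ·)) :
    x = sortedWord fun i => x.count i :=
  List.Perm.eq_of_pairwise' hx (pairwise_sortedWord _)
    (List.perm_iff_count.2 fun i => (count_sortedWord (fun i => x.count i) i).symm)

end SortedWord

/-- The automaton that accepts the tapes with sorted contents: it is in the state `1` after the
left endmarker, in `a + 2` after the letter `a`, and in `n + 2` after the right endmarker. -/
def phaseNFA (n : ℕ) : NFA (TapeSym (Fin n)) (Fin (n + 3)) where
  step i s := {j | match s with
    | .left => i.val = 0 ∧ j.val = 1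
    | .letter a => 1 ≤ i.val ∧ i.val ≤ a.val + 2 ∧ j.val = a.val + 2
    | .right => 1 ≤ i.val ∧ i.val ≤ n + 1 ∧ j.val = n + 2}
  start := {0}
  accept := {Fin.last (n + 2)}

namespace phaseNFA

variable {n : ℕ}

theorem mem_evalFrom_cons {s : TapeSym (Fin n)} {w : List (TapeSym (Fin n))} {i j : Fin (n + 3)} :
    j ∈ (phaseNFA n).evalFrom {i} (s :: w) ↔
      ∃ k ∈ (phaseNFA n).step i s, j ∈ (phaseNFA n).evalFrom {k} w := by
  rw [NFA.evalFrom_cons, NFA.stepSet_singleton, NFA.mem_evalFrom_iff_exists]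

theorem mem_evalFrom_of_pairwise {x : List (Fin n)} {i : Fin (n + 3)} (h1 : 1 ≤ i.val)
    (hin : i.val ≤ n + 1) (hx : x.Pairwise (· ≤ ·)) (hi : ∀ a ∈ x, i.val ≤ a.val + 2) :
    Fin.last (n + 2) ∈
      (phaseNFA n).evalFrom {i} (x.map TapeSym.letter ++ [TapeSym.right]) := by
  induction x generalizing i with
  | nil => exact mem_evalFrom_cons.2 ⟨Fin.last (n + 2), ⟨h1, hin, rfl⟩, rfl⟩
  | cons a x ih =>
    obtain ⟨ha, hx⟩ := List.pairwise_cons.1 hx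
    refine mem_evalFrom_cons.2 ⟨⟨a.val + 2, by omega⟩, ⟨h1, hi a (by simp), rfl⟩,
      ih (Nat.le_add_left _ _) (Nat.succ_le_succ a.isLt) hx fun b hb => ?_⟩
    exact Nat.add_le_add_right (Fin.le_def.1 (ha b hb)) 2

theorem exists_pairwise_of_mem_evalFrom {w : List (TapeSym (Fin n))} {i : Fin (n + 3)}
    (h1 : 1 ≤ i.val) (hin : i.val ≤ n + 1)
    (h : Fin.last (n + 2) ∈ (phaseNFA n).evalFrom {i} w) :
    ∃ x : List (Fin n), w = x.map TapeSym.letter ++ [TapeSym.right] ∧ x.Pairwise (· ≤ ·) ∧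
      ∀ a ∈ x, i.val ≤ a.val + 2 := by
  induction w generalizing i with
  | nil =>
    have := congrArg Fin.val (Set.mem_singleton_iff.1 h)
    simp at this
    omega
  | cons s w ih =>
    obtain ⟨k, hs, hw⟩ := mem_evalFrom_cons.1 h
    cases s with
    | left => exact absurd hs.1 (by omega)
    | letter a =>
      obtain ⟨-, hia, hk⟩ := hs
      obtain ⟨x, rfl, hx, hkx⟩ := ih (by omega) (by omega) hw
      refine ⟨a :: x, rfl, List.pairwise_cons.2 ⟨fun b hb => ?_, hx⟩, ?_⟩
      · have := hkx b hb
        rw [Fin.le_def]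
        omega
      · rw [List.forall_mem_cons]
        exact ⟨hia, fun b hb => by have := hkx b hb; omega⟩
    | right =>
      cases w with
      | nil => exact ⟨[], rfl, .nil, by simp⟩
      | cons s w =>
        obtain ⟨k', hs', -⟩ := mem_evalFrom_cons.1 hw
        have hk := hs.2.2
        cases s with
        | left => exact absurd hs'.1 (by omega)
        | letter a => exact absurd hs'.2.1 (by omega)
        | right => exact absurd hs'.2.1 (by omega)

theorem last_mem_evalFrom_zero_iff {w : List (TapeSym (Fin n))} :
    Fin.last (n + 2) ∈ (phaseNFA n).evalFrom {0} w ↔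
      ∃ x : List (Fin n), x.Pairwise (· ≤ ·) ∧ w = NPDA.tape x := by
  constructor
  · intro h
    cases w with
    | nil => exact absurd (Set.mem_singleton_iff.1 h) (by simp [Fin.ext_iff])
    | cons s w =>
      obtain ⟨k, hs, hw⟩ := mem_evalFrom_cons.1 h
      cases s with
      | left =>
        have hk := hs.2
        obtain ⟨x, rfl, hx, -⟩ := exists_pairwise_of_mem_evalFrom (by omega) (by omega) hw
        exact ⟨x, hx, rfl⟩
      | letter a => exact absurd hs.1 (by simp)
      | right => exact absurd hs.1 (by simp)
  · rintro ⟨x, hx, rfl⟩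
    exact mem_evalFrom_cons.2 ⟨⟨1, by omega⟩, ⟨rfl, rfl⟩,
      mem_evalFrom_of_pairwise le_rfl (Nat.le_add_left _ _) hx fun _ _ => by simp⟩

end phaseNFA

/-- The contribution of a tape symbol to the vector of letter multiplicities. -/
def tapeWeight {A : Type} [DecidableEq A] : TapeSym A → A → ℕ
  | .letter a => Pi.single a 1
  | _ => 0

theorem sum_map_tapeWeight_tape {A : Type} [DecidableEq A] (x : List A) :
    ((NPDA.tape x).map tapeWeight).sum = fun a => x.count a := by
  have sum_letters : ((x.map TapeSym.letter).map tapeWeight).sum = fun a => x.count a := by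
    induction x with
    | nil => rfl
    | cons b x ih =>
      rw [List.map_cons, List.map_cons, List.sum_cons, ih]
      funext a
      by_cases h : b = a
      · subst h; simp [tapeWeight, add_comm]
      · simp [tapeWeight, h, Ne.symm h]
  simpa [NPDA.tape, tapeWeight] using sum_letters

theorem phases_inter_phaseNFA {N : Type*} {n : ℕ} (g : WordGrammar N (TapeSym (Fin n))) :
    (g.inter (phaseNFA n) tapeWeight).Phases (fun a => a.val + 2) (fun X => X.2.1.val)
      (fun X => X.2.2.val) where
  leaf := by
    rintro ⟨X, i, j⟩ v ⟨a, -, hj, rfl⟩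
    match a with
    | none =>
      have hji : j = i := hj
      simp [hji]
    | some s =>
      simp only [Option.toList_some, NFA.evalFrom_singleton, NFA.stepSet_singleton] at hj
      match s with
      | .left => simp [hj.1, tapeWeight]
      | .right => simpa [hj.2.2, tapeWeight] using hj.2.1.trans (Nat.le_succ _)
      | .letter a =>
        obtain ⟨-, hia, hja⟩ := hj
        refine ⟨hia.trans hja.ge, fun b hb => ?_⟩
        obtain rfl : b = a := by
          by_contra h
          simp [tapeWeight, h] at hb
        exact ⟨hia, hja.ge⟩
  bin := by
    rintro X Y Z ⟨-, hYX, hZY, hZX⟩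
    simp only [hYX, hZY, hZX, and_self]

theorem NPDA.isStratifiedSemilinearSet {n : ℕ} {B : Type} (M : NPDA (Fin n) B) :
    IsStratifiedSemilinearSet {v | [] ∈ M.validOutputs (sortedWord v)} := by
  obtain ⟨N, _, g, S, hg⟩ := M.exists_wordGrammar
  have hmono : StrictMono fun a : Fin n => a.val + 2 := fun a b h => Nat.add_lt_add_right h 2
  suffices key : {v | [] ∈ M.validOutputs (sortedWord v)} =
      {v | ∃ U, (g.inter (phaseNFA n) tapeWeight).Derives (S, 0, Fin.last (n + 2)) U v} from
    key ▸ (phases_inter_phaseNFA g).isStratifiedSemilinearSet hmono _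
  ext v
  simp only [Set.mem_ofPred_eq, WordGrammar.exists_inter_derives_iff,
    phaseNFA.last_mem_evalFrom_zero_iff]
  constructor
  · exact fun h => ⟨_, (hg _).2 h, ⟨_, pairwise_sortedWord v, rfl⟩, by
      simp only [sum_map_tapeWeight_tape, count_sortedWord]⟩
  · rintro ⟨_, hw, ⟨x, hx, rfl⟩, rfl⟩
    rw [sum_map_tapeWeight_tape, ← eq_sortedWord hx]
    exact (hg x).1 hw

/-! ### Constructions of pushdown automata -/

namespace NPDA

variable {A B : Type} {M : NPDA A B}

theorem Step.notMem_halt {c d : M.Config} (h : M.Step c d) : c.state ∉ M.halt := by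
  cases h <;> assumption

theorem stepsIn_zero_iff {c d : M.Config} : M.StepsIn 0 c d ↔ d = c :=
  ⟨fun h => by cases h; rfl, fun h => h ▸ .refl c⟩

theorem stepsIn_succ_iff {t : ℕ} {c d : M.Config} :
    M.StepsIn (t + 1) c d ↔ ∃ e, M.Step c e ∧ M.StepsIn t e d := by
  constructor
  · intro h
    induction t generalizing d with
    | zero =>
      obtain - | @⟨_, _, e, _, h, hs⟩ := h
      cases stepsIn_zero_iff.1 h
      exact ⟨d, hs, .refl d⟩
    | succ t ih =>
      obtain - | @⟨_, _, e, _, h, hs⟩ := h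
      obtain ⟨e', he', h⟩ := ih h
      exact ⟨e', he', .tail h hs⟩
  · rintro ⟨e, he, h⟩
    induction h with
    | refl => exact .tail (.refl c) he
    | tail _ hs ih => exact .tail (ih he) hs

section Choice

variable {ι : Type} [Finite ι]

/-- The nondeterministic choice between the machines `M i`: the initial state, here `none`, moves
to the initial configuration of any `M i` without reading, and rejects if there is no `i`. -/
noncomputable def choice (M : ι → NPDA A B) : NPDA A B where
  Q := Option (Σ i, (M i).Q)
  stackSym := Option (Σ i, (M i).stackSym)
  finite_Q := by
    have := fun i => (M i).finite_Q
    infer_instance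
  finite_stackSym := by
    have := fun i => (M i).finite_stackSym
    infer_instance
  δ q a Z := open Classical in match q, a, Z with
    | none, none, none =>
      (Set.finite_range fun i => (some ⟨i, (M i).q₀⟩, [some ⟨i, (M i).Z₀⟩], none)).toFinset
    | some ⟨i, q⟩, a, some ⟨j, Z⟩ =>
      if h : j = i then
        (((M i).δ q a (h ▸ Z)).finite_toSet.image fun e =>
          (some ⟨i, e.1⟩, e.2.1.map fun Y => some ⟨i, Y⟩, e.2.2)).toFinset
      else ∅
    | _, _, _ => ∅
  q₀ := none
  Z₀ := none
  acc := {q | ∃ i, ∃ q' ∈ (M i).acc, q = some ⟨i, q'⟩}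
  rej := {q | (IsEmpty ι ∧ q = none) ∨ ∃ i, ∃ q' ∈ (M i).rej, q = some ⟨i, q'⟩}
  disjoint_acc_rej := by
    rw [Set.disjoint_left]
    rintro _ ⟨i, q, hq, rfl⟩ (⟨-, h⟩ | ⟨j, q', hq', h⟩)
    · cases h
    · cases h
      exact Set.disjoint_left.1 (M i).disjoint_acc_rej hq hq'

variable {M : ι → NPDA A B} {i : ι}

/-- A state of `M i` as a state of the choice machine. -/
def choiceState (i : ι) (q : (M i).Q) : (choice M).Q := some ⟨i, q⟩

/-- A stack symbol of `M i` as a stack symbol of the choice machine. -/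
def choiceSym (i : ι) (Z : (M i).stackSym) : (choice M).stackSym := some ⟨i, Z⟩

/-- A configuration of `M i` as a configuration of the choice machine. -/
def choiceConfig (i : ι) (c : (M i).Config) : (choice M).Config :=
  ⟨choiceState i c.state, c.input, c.stack.map (choiceSym i), c.output⟩

theorem choiceState_mem_acc {q : (M i).Q} :
    choiceState i q ∈ (choice M).acc ↔ q ∈ (M i).acc := by
  constructor
  · rintro ⟨j, q, hq, h⟩
    cases h
    exact hq
  · exact fun h => ⟨i, _, h, rfl⟩

theorem choiceState_mem_rej {q : (M i).Q} :
    choiceState i q ∈ (choice M).rej ↔ q ∈ (M i).rej := by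
  constructor
  · rintro (⟨-, h⟩ | ⟨j, q, hq, h⟩)
    · cases h
    · cases h
      exact hq
  · exact fun h => .inr ⟨i, _, h, rfl⟩

theorem choiceState_mem_halt {q : (M i).Q} :
    choiceState i q ∈ (choice M).halt ↔ q ∈ (M i).halt :=
  or_congr choiceState_mem_acc choiceState_mem_rej

theorem initial_mem_halt_choice_iff : (choice M).q₀ ∈ (choice M).halt ↔ IsEmpty ι := by
  constructor
  · rintro (⟨i, q, -, h⟩ | ⟨h, -⟩ | ⟨i, q, -, h⟩)
    · cases h
    · exact h
    · cases h
  · exact fun h => .inr (.inl ⟨h, rfl⟩)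

theorem mem_choice_δ {q : (M i).Q} {a : Option (TapeSym A)} {Z : (M i).stackSym}
    {e : (choice M).Q × List (choice M).stackSym × Option B} :
    e ∈ (choice M).δ (choiceState i q) a (choiceSym i Z) ↔
      ∃ f ∈ (M i).δ q a Z, (choiceState i f.1, f.2.1.map (choiceSym i), f.2.2) = e := by
  have h : (choice M).δ (choiceState i q) a (choiceSym i Z) = _ := dif_pos rfl
  rw [h]
  exact Set.Finite.mem_toFinset _

theorem choice_step_config_iff {c : (M i).Config} {d : (choice M).Config} :
    (choice M).Step (choiceConfig i c) d ↔ ∃ e, (M i).Step c e ∧ choiceConfig i e = d := by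
  constructor
  · obtain ⟨q, w, s, o⟩ := c
    intro h
    cases s with
    | nil => cases h
    | cons Z s =>
      cases h with
      | read hq h =>
        obtain ⟨f, hf, h⟩ := mem_choice_δ.1 h
        cases h
        exact ⟨_, .read (mt choiceState_mem_halt.2 hq) hf, by simp [choiceConfig]⟩
      | lam hq h =>
        obtain ⟨f, hf, h⟩ := mem_choice_δ.1 h
        cases h
        exact ⟨_, .lam (mt choiceState_mem_halt.2 hq) hf, by simp [choiceConfig]⟩
  · rintro ⟨e, h, rfl⟩
    cases h with
    | read hq h =>
      simp only [choiceConfig, List.map_append, List.map_cons]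
      exact .read (mt choiceState_mem_halt.1 hq) (mem_choice_δ.2 ⟨_, h, rfl⟩)
    | lam hq h =>
      simp only [choiceConfig, List.map_append, List.map_cons]
      exact .lam (mt choiceState_mem_halt.1 hq) (mem_choice_δ.2 ⟨_, h, rfl⟩)

theorem choice_step_init_iff {x : List A} {d : (choice M).Config} :
    (choice M).Step ((choice M).init x) d ↔ ∃ i, choiceConfig i ((M i).init x) = d := by
  constructor
  · intro h
    cases h with
    | read hq h => exact absurd h (Finset.notMem_empty _)
    | lam hq h =>
      obtain ⟨i, h⟩ := (Set.Finite.mem_toFinset _).1 h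
      cases h
      exact ⟨i, rfl⟩
  · rintro ⟨i, rfl⟩
    have hq : (choice M).q₀ ∉ (choice M).halt := fun h =>
      (initial_mem_halt_choice_iff.1 h).elim i
    have h : (choiceState i (M i).q₀, [choiceSym i (M i).Z₀], none) ∈
        (choice M).δ (choice M).q₀ none (choice M).Z₀ :=
      (Set.Finite.mem_toFinset _).2 ⟨i, rfl⟩
    exact .lam hq h

theorem choice_stepsIn_config_iff {t : ℕ} {c : (M i).Config} {d : (choice M).Config} :
    (choice M).StepsIn t (choiceConfig i c) d ↔
      ∃ e, (M i).StepsIn t c e ∧ choiceConfig i e = d := by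
  induction t generalizing c with
  | zero => simp only [stepsIn_zero_iff, exists_eq_left, eq_comm (a := d)]
  | succ t ih =>
    simp only [stepsIn_succ_iff, choice_step_config_iff]
    constructor
    · rintro ⟨_, ⟨c', hc, rfl⟩, h⟩
      obtain ⟨e, he, rfl⟩ := ih.1 h
      exact ⟨e, ⟨c', hc, he⟩, rfl⟩
    · rintro ⟨e, ⟨c', hc, he⟩, rfl⟩
      exact ⟨_, ⟨c', hc, rfl⟩, ih.2 ⟨e, he, rfl⟩⟩

theorem choice_stepsIn_init_iff {x : List A} {t : ℕ} {d : (choice M).Config} :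
    (choice M).StepsIn (t + 1) ((choice M).init x) d ↔
      ∃ i e, (M i).StepsIn t ((M i).init x) e ∧ choiceConfig i e = d := by
  simp only [stepsIn_succ_iff, choice_step_init_iff]
  constructor
  · rintro ⟨_, ⟨i, rfl⟩, h⟩
    exact ⟨i, choice_stepsIn_config_iff.1 h⟩
  · rintro ⟨i, h⟩
    exact ⟨_, ⟨i, rfl⟩, choice_stepsIn_config_iff.2 h⟩

theorem Terminating.choice (hM : ∀ i, (M i).Terminating) : (choice M).Terminating := by
  choose C hC using hM
  obtain ⟨K, hK⟩ := (Set.finite_range C).bddAbove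
  refine ⟨K + 1, fun x t d h => ?_⟩
  cases t with
  | zero =>
    cases stepsIn_zero_iff.1 h
    refine ⟨Nat.zero_le _, fun hd => initial_mem_halt_choice_iff.2 ⟨fun i => ?_⟩⟩
    exact hd _ (choice_step_init_iff.2 ⟨i, rfl⟩)
  | succ t =>
    obtain ⟨i, e, he, rfl⟩ := choice_stepsIn_init_iff.1 h
    obtain ⟨ht, hhalt⟩ := hC i x t e he
    refine ⟨?_, fun hd => choiceState_mem_halt.2
      (hhalt fun f hf => hd _ (choice_step_config_iff.2 ⟨f, hf, rfl⟩))⟩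
    have hle := Nat.mul_le_mul_right (x.length + 1) (hK (Set.mem_range_self i))
    rw [add_one_mul]
    omega

theorem validOutputs_choice (x : List A) :
    (choice M).validOutputs x = ⋃ i, (M i).validOutputs x := by
  ext y
  rw [Set.mem_iUnion]
  constructor
  · rintro ⟨t, d, h, hacc, rfl⟩
    cases t with
    | zero =>
      cases stepsIn_zero_iff.1 h
      obtain ⟨i, q, -, h⟩ := hacc
      cases h
    | succ t =>
      obtain ⟨i, e, he, rfl⟩ := choice_stepsIn_init_iff.1 h
      exact ⟨i, t, e, he, choiceState_mem_acc.1 hacc, rfl⟩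
  · rintro ⟨i, t, e, he, hacc, hy⟩
    exact ⟨t + 1, _, choice_stepsIn_init_iff.2 ⟨i, e, he, rfl⟩, choiceState_mem_acc.2 hacc, hy⟩

end Choice

/-- `M.HaltsIn t c d`: the only computation from `c` is deterministic and halts after `t` steps in
the configuration `d`. -/
inductive HaltsIn (M : NPDA A B) : ℕ → M.Config → M.Config → Prop
  | halt {c : M.Config} (hc : c.state ∈ M.halt) : HaltsIn M 0 c c
  | step {t : ℕ} {c c' d : M.Config} (hc : ∀ e, M.Step c e ↔ e = c') (h : HaltsIn M t c' d) :
      HaltsIn M (t + 1) c d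

namespace HaltsIn

variable {t s : ℕ} {c d e : M.Config}

theorem state_mem_halt (h : M.HaltsIn t c d) : d.state ∈ M.halt := by
  induction h with
  | halt hc => exact hc
  | step _ _ ih => exact ih

theorem stepsIn (h : M.HaltsIn t c d) : M.StepsIn t c d := by
  induction h with
  | halt => exact .refl _
  | step hc _ ih => exact stepsIn_succ_iff.2 ⟨_, (hc _).2 rfl, ih⟩

theorem le_and_eq_or_step (h : M.HaltsIn t c d) (hs : M.StepsIn s c e) :
    s ≤ t ∧ (e = d ∨ ∃ e', M.Step e e') := by
  induction h generalizing s with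
  | halt hc =>
    cases s with
    | zero => exact ⟨le_rfl, .inl (stepsIn_zero_iff.1 hs)⟩
    | succ s =>
      obtain ⟨_, hstep, -⟩ := stepsIn_succ_iff.1 hs
      exact absurd hc hstep.notMem_halt
  | step hc _ ih =>
    cases s with
    | zero =>
      cases stepsIn_zero_iff.1 hs
      exact ⟨Nat.zero_le _, .inr ⟨_, (hc _).2 rfl⟩⟩
    | succ s =>
      obtain ⟨c', hstep, hs⟩ := stepsIn_succ_iff.1 hs
      cases (hc c').1 hstep
      exact (ih hs).imp_left Nat.succ_le_succ

theorem validOutputs_eq {x : List A} (h : M.HaltsIn t (M.init x) d) :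
    M.validOutputs x = {y | d.state ∈ M.acc ∧ d.output = y} := by
  ext y
  constructor
  · rintro ⟨s, e, hs, hacc, hy⟩
    rcases (h.le_and_eq_or_step hs).2 with rfl | ⟨e', he'⟩
    · exact ⟨hacc, hy⟩
    · exact absurd (.inl hacc) he'.notMem_halt
  · exact fun ⟨hacc, hy⟩ => ⟨t, d, h.stepsIn, hacc, hy⟩

theorem terminating {C : ℕ} {t : List A → ℕ} {d : List A → M.Config}
    (h : ∀ x, M.HaltsIn (t x) (M.init x) (d x)) (ht : ∀ x, t x ≤ C * (x.length + 1)) :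
    M.Terminating := by
  refine ⟨C, fun x s e hs => ?_⟩
  obtain ⟨hst, hd | ⟨e', he'⟩⟩ := (h x).le_and_eq_or_step hs
  · exact ⟨hst.trans (ht x), fun _ => hd ▸ (h x).state_mem_halt⟩
  · exact ⟨hst.trans (ht x), fun he => absurd he' (he e')⟩

end HaltsIn

section ZeroSum

/-- The stack of `NPDA.zeroSum` when the sum of the weights read so far is `z`: the bottom symbol
`0` below as many copies of the sign of `z` as its absolute value says. -/
noncomputable def signStack (z : ℤ) : List SignType :=
  List.replicate z.natAbs (SignType.sign z) ++ [0]

/-- The string that replaces the top `Z` of a stack `signStack z` when the weight `w` is read. -/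
def signPush (w Z : SignType) : List SignType :=
  if w = 0 then [Z] else if Z = -w then [] else [w, Z]

theorem signStack_add {z : ℤ} {w : SignType} (hw : w ≠ 0) (hz : z = 0 ∨ SignType.sign z = w) :
    signStack (z + w) = w :: signStack z := by
  have habs : (z + w).natAbs = z.natAbs + 1 := by
    cases w <;> simp_all [sign_eq_one_iff, sign_eq_neg_one_iff] <;> omega
  have hsign : SignType.sign (z + w) = w := by
    cases w <;> simp_all [sign_eq_one_iff, sign_eq_neg_one_iff] <;> omega
  rw [signStack, habs, hsign, List.replicate_succ, List.cons_append, signStack]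
  rcases hz with rfl | rfl <;> rfl

theorem exists_signStack_eq_cons (z : ℤ) :
    ∃ s, signStack z = SignType.sign z :: s ∧
      ∀ w : SignType, signPush w (SignType.sign z) ++ s = signStack (z + w) := by
  rcases eq_or_ne z 0 with rfl | hz
  · refine ⟨[], by simp [signStack], fun w => ?_⟩
    rcases eq_or_ne w 0 with rfl | hw
    · simp [signPush, signStack]
    · rw [signStack_add hw (.inl rfl)]
      simp [signPush, signStack, hw, eq_comm]
  · obtain ⟨σ, hσ⟩ : ∃ σ, σ = SignType.sign z := ⟨_, rfl⟩
    have hσ0 : σ ≠ 0 := by simpa [hσ] using hz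
    have hlower : z - σ = 0 ∨ SignType.sign (z - σ) = σ := by
      rcases lt_or_gt_of_ne hz with hneg | hpos
      · rw [sign_neg hneg] at hσ
        simp only [hσ, SignType.coe_neg_one, sign_eq_neg_one_iff]
        omega
      · rw [sign_pos hpos] at hσ
        simp only [hσ, SignType.coe_one, sign_eq_one_iff]
        omega
    have hcons : signStack z = σ :: signStack (z - σ) := by
      simpa using signStack_add hσ0 hlower
    rw [← hσ]
    refine ⟨signStack (z - σ), hcons, fun w => ?_⟩
    unfold signPush
    split_ifs with hw hσw
    · simp [hw, hcons]
    · simp [hσw]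
    · have eq_of_ne_neg : ∀ w σ : SignType, w ≠ 0 → σ ≠ 0 → σ ≠ -w → w = σ := by decide
      have hwσ := eq_of_ne_neg w σ hw hσ0 hσw
      rw [signStack_add hw (.inr (hσ.symm.trans hwσ.symm)), hcons, hwσ]
      rfl

/-- The machine that accepts with empty output if the weights of the input letters sum up to
zero. The state `none` means running and `some b` means halted with the verdict `b`. -/
abbrev zeroSum (ω : A → SignType) : NPDA A B where
  Q := Option Bool
  stackSym := SignType
  finite_Q := inferInstance
  finite_stackSym := inferInstance
  δ q c Z := match q, c with
    | none, some .left => {(none, [Z], none)}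
    | none, some (.letter a) => {(none, signPush (ω a) Z, none)}
    | none, some .right => {(some (decide (Z = 0)), [Z], none)}
    | _, _ => ∅
  q₀ := none
  Z₀ := 0
  acc := {some true}
  rej := {some false}
  disjoint_acc_rej := by simp

variable {ω : A → SignType}

theorem zeroSum_step_iff {c : TapeSym A} {w : List (TapeSym A)} {Z : SignType}
    {s : List SignType} {o : List B} {d : (zeroSum (B := B) ω).Config} :
    (zeroSum ω).Step ⟨none, c :: w, Z :: s, o⟩ d ↔
      ∃ e ∈ (zeroSum (B := B) ω).δ none (some c) Z,
        d = ⟨e.1, w, e.2.1 ++ s, o ++ e.2.2.toList⟩ := by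
  constructor
  · intro h
    cases h with
    | read hq h => exact ⟨_, h, rfl⟩
    | lam hq h => exact absurd h (Finset.notMem_empty _)
  · rintro ⟨e, he, rfl⟩
    refine .read ?_ he
    rintro (h | h) <;> cases h

theorem zeroSum_step_letter_iff {a : A} {w : List (TapeSym A)} {z : ℤ}
    {d : (zeroSum (B := B) ω).Config} :
    (zeroSum ω).Step ⟨none, .letter a :: w, signStack z, []⟩ d ↔
      d = ⟨none, w, signStack (z + ω a), []⟩ := by
  obtain ⟨s, hs, hpush⟩ := exists_signStack_eq_cons z
  rw [hs, zeroSum_step_iff, ← hpush]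
  simp

theorem zeroSum_step_right_iff {z : ℤ} {d : (zeroSum (B := B) ω).Config} :
    (zeroSum ω).Step ⟨none, [.right], signStack z, []⟩ d ↔
      d = ⟨some (decide (z = 0)), [], signStack z, []⟩ := by
  obtain ⟨s, hs, -⟩ := exists_signStack_eq_cons z
  rw [hs, zeroSum_step_iff]
  simp [sign_eq_zero_iff]

theorem zeroSum_step_init_iff {x : List A} {d : (zeroSum (B := B) ω).Config} :
    (zeroSum ω).Step ((zeroSum ω).init x) d ↔
      d = ⟨none, x.map .letter ++ [.right], signStack 0, []⟩ := by
  refine zeroSum_step_iff.trans ?_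
  simp [signStack]

theorem zeroSum_haltsIn_letters (x : List A) (z : ℤ) :
    (zeroSum (B := B) ω).HaltsIn (x.length + 1)
      ⟨none, x.map .letter ++ [.right], signStack z, []⟩
      ⟨some (decide (z + (x.map fun a => (ω a : ℤ)).sum = 0)), [],
        signStack (z + (x.map fun a => (ω a : ℤ)).sum), []⟩ := by
  induction x generalizing z with
  | nil =>
    simp only [List.map_nil, List.sum_nil, add_zero]
    exact .step (fun _ => zeroSum_step_right_iff) (.halt (by
      by_cases hz : z = 0
      · exact .inl (by simp [hz])
      · exact .inr (by simp [hz])))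
  | cons a x ih =>
    rw [List.map_cons, List.map_cons, List.sum_cons, ← add_assoc]
    exact .step (fun _ => zeroSum_step_letter_iff) (ih _)

theorem zeroSum_haltsIn (x : List A) :
    (zeroSum (B := B) ω).HaltsIn (x.length + 2) ((zeroSum ω).init x)
      ⟨some (decide ((x.map fun a => (ω a : ℤ)).sum = 0)), [],
        signStack (x.map fun a => (ω a : ℤ)).sum, []⟩ := by
  have h := zeroSum_haltsIn_letters (B := B) (ω := ω) x 0
  rw [zero_add] at h
  exact .step (fun _ => zeroSum_step_init_iff) h

theorem zeroSum_terminating : (zeroSum (B := B) ω).Terminating :=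
  HaltsIn.terminating (C := 2) zeroSum_haltsIn fun x => by omega

theorem validOutputs_zeroSum (x : List A) :
    (zeroSum (B := B) ω).validOutputs x = {y | (x.map fun a => (ω a : ℤ)).sum = 0 ∧ y = []} := by
  rw [(zeroSum_haltsIn x).validOutputs_eq]
  simp [eq_comm]

end ZeroSum

end NPDA

/-! ### The hierarchies -/

namespace FunClass

variable {F G : FunClass} {A B : Type} [Finite A] [Nonempty A] [Finite B] [Nonempty B]
  {f : List A → Set (List B)} {k m : ℕ}

theorem mem_conj_succ : f ∈ F.conj (k + 1) A B ↔
    ∃ g : Fin (k + 1) → List A → Set (List B), (∀ i, g i ∈ F A B) ∧ ∀ x, f x = ⋂ i, g i x := by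
  induction k generalizing f with
  | zero =>
    constructor
    · exact fun h => ⟨fun _ => f, fun _ => h, fun x => (Set.iInter_const _).symm⟩
    · rintro ⟨g, hg, h⟩
      obtain rfl : f = g 0 := funext fun x => (h x).trans (iInf_unique (ι := Fin 1) fun i => g i x)
      exact hg 0
  | succ k ih =>
    constructor
    · rintro ⟨f₁, h₁, f₂, h₂, h⟩
      obtain ⟨g, hg, hx⟩ := ih.1 h₁
      refine ⟨Fin.snoc g f₂, fun i => ?_, fun x => ?_⟩
      · refine Fin.lastCases ?_ (fun i => ?_) i
        · simpa using h₂
        · simpa using hg i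
      · ext y
        simp [h x, hx x, Fin.forall_fin_succ']
    · rintro ⟨g, hg, h⟩
      refine ⟨fun x => ⋂ i : Fin (k + 1), g i.castSucc x,
        ih.2 ⟨_, fun i => hg i.castSucc, fun _ => rfl⟩, g (Fin.last _), hg _, fun x => ?_⟩
      ext y
      simp [h x, Fin.forall_fin_succ']

theorem mem_conj_iff {ι : Type} [Finite ι] [Nonempty ι] (hι : Nat.card ι = k) :
    f ∈ F.conj k A B ↔
      ∃ g : ι → List A → Set (List B), (∀ i, g i ∈ F A B) ∧ ∀ x, f x = ⋂ i, g i x := by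
  obtain ⟨k, rfl⟩ : ∃ l, k = l + 1 :=
    Nat.exists_eq_succ_of_ne_zero (by rw [← hι]; exact Nat.card_pos.ne')
  let e : ι ≃ Fin (k + 1) := Finite.equivFinOfCardEq hι
  rw [mem_conj_succ]
  constructor
  · rintro ⟨g, hg, h⟩
    exact ⟨g ∘ e, fun i => hg _,
      fun x => (h x).trans (e.iInf_comp (g := fun i => g i x)).symm⟩
  · rintro ⟨g, hg, h⟩
    exact ⟨g ∘ e.symm, fun i => hg _,
      fun x => (h x).trans (e.symm.iInf_comp (g := fun i => g i x)).symm⟩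

theorem mem_conj_iff_fin (hk : 1 ≤ k) : f ∈ F.conj k A B ↔
    ∃ g : Fin k → List A → Set (List B), (∀ i, g i ∈ F A B) ∧ ∀ x, f x = ⋂ i, g i x :=
  have : Nonempty (Fin k) := ⟨⟨0, hk⟩⟩
  mem_conj_iff (Nat.card_fin k)

theorem conj_wedge_subset (hk : 1 ≤ k) (hm : 1 ≤ m) :
    (F.conj k).wedge (F.conj m) ⊆ F.conj (k + m) := by
  rintro A B _ _ _ _ f ⟨f₁, h₁, f₂, h₂, h⟩
  obtain ⟨g₁, hg₁, h₁⟩ := (mem_conj_iff_fin hk).1 h₁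
  obtain ⟨g₂, hg₂, h₂⟩ := (mem_conj_iff_fin hm).1 h₂
  have : Nonempty (Fin k) := ⟨⟨0, hk⟩⟩
  refine (mem_conj_iff (ι := Fin k ⊕ Fin m) (by simp)).2 ⟨Sum.elim g₁ g₂, ?_, fun x => ?_⟩
  · rintro (i | i)
    · exact hg₁ i
    · exact hg₂ i
  · rw [h x, h₁ x, h₂ x]
    ext y
    simp

theorem conj_vee_subset (hF : F.vee F ⊆ F) (hk : 1 ≤ k) (hm : 1 ≤ m) :
    (F.conj k).vee (F.conj m) ⊆ F.conj (k * m) := by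
  rintro A B _ _ _ _ f ⟨f₁, h₁, f₂, h₂, h⟩
  obtain ⟨g₁, hg₁, h₁⟩ := (mem_conj_iff_fin hk).1 h₁
  obtain ⟨g₂, hg₂, h₂⟩ := (mem_conj_iff_fin hm).1 h₂
  have : Nonempty (Fin k) := ⟨⟨0, hk⟩⟩
  have : Nonempty (Fin m) := ⟨⟨0, hm⟩⟩
  refine (mem_conj_iff (ι := Fin k × Fin m) (by simp)).2
    ⟨fun i x => g₁ i.1 x ∪ g₂ i.2 x, fun i => ?_, fun x => ?_⟩
  · exact hF A B _ ⟨_, hg₁ i.1, _, hg₂ i.2, fun _ => rfl⟩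
  · rw [h x, h₁ x, h₂ x]
    ext y
    simp only [Set.mem_union, Set.mem_iInter, Prod.forall]
    constructor
    · rintro (h | h) i j
      · exact .inl (h i)
      · exact .inr (h j)
    · intro h
      by_contra! hne
      obtain ⟨⟨i, hi⟩, j, hj⟩ := hne
      exact (h i j).elim hi hj

theorem mem_conj_of_mem (hk : 1 ≤ k) (hf : f ∈ F A B) : f ∈ F.conj k A B :=
  have : Nonempty (Fin k) := ⟨⟨0, hk⟩⟩
  (mem_conj_iff_fin hk).2 ⟨fun _ => f, fun _ => hf, fun _ => (Set.iInter_const _).symm⟩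

theorem exists_mem_superset (hk : 1 ≤ k) (hf : f ∈ F.conj k A B) :
    ∃ g ∈ F A B, ∀ x, f x ⊆ g x := by
  obtain ⟨g, hg, h⟩ := (mem_conj_iff_fin hk).1 hf
  exact ⟨g ⟨0, hk⟩, hg _, fun x => by rw [h x]; exact Set.iInter_subset _ _⟩

theorem conj_max_subset_wedge (hk : 1 ≤ k) (hm : 1 ≤ m) :
    F.conj (max k m) ⊆ (F.conj k).wedge (F.conj m) := by
  intro A B _ _ _ _ f hf
  obtain ⟨g, hg, h⟩ := exists_mem_superset (hk.trans (le_max_left k m)) hf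
  rcases le_total m k with hkm | hkm
  · rw [max_eq_left hkm] at hf
    exact ⟨f, hf, g, mem_conj_of_mem hm hg, fun x => (Set.inter_eq_left.2 (h x)).symm⟩
  · rw [max_eq_right hkm] at hf
    exact ⟨g, mem_conj_of_mem hk hg, f, hf, fun x => (Set.inter_eq_right.2 (h x)).symm⟩

theorem conj_max_subset_vee (hF : ∀ (A B : Type) [Finite A] [Nonempty A] [Finite B] [Nonempty B],
    (fun _ => ∅) ∈ F A B) (hk : 1 ≤ k) (hm : 1 ≤ m) :
    F.conj (max k m) ⊆ (F.conj k).vee (F.conj m) := by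
  intro A B _ _ _ _ f hf
  rcases le_total m k with hkm | hkm
  · rw [max_eq_left hkm] at hf
    exact ⟨f, hf, _, mem_conj_of_mem hm (hF A B), fun x => (Set.union_empty _).symm⟩
  · rw [max_eq_right hkm] at hf
    exact ⟨_, mem_conj_of_mem hk (hF A B), f, hf, fun x => (Set.empty_union _).symm⟩

theorem conj_subset_conj_succ (hk : 1 ≤ k) : F.conj k ⊆ F.conj (k + 1) := by
  intro A B _ _ _ _ f hf
  obtain ⟨g, hg, h⟩ := exists_mem_superset hk hf
  obtain ⟨k, rfl⟩ := Nat.exists_eq_add_of_le' hk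
  exact ⟨f, hf, g, hg, fun x => (Set.inter_eq_left.2 (h x)).symm⟩

end FunClass

section Base

variable {A B : Type} [Finite A] [Nonempty A] [Finite B] [Nonempty B]

theorem iUnion_mem_baseCFLMV {ι : Type} [Finite ι] {f : ι → List A → Set (List B)}
    (hf : ∀ i, f i ∈ baseCFLMV A B) : (fun x => ⋃ i, f i x) ∈ baseCFLMV A B := by
  choose M hM hfM using hf
  refine ⟨.choice M, .choice hM, fun x => ?_⟩
  rw [NPDA.validOutputs_choice]
  exact Set.iUnion_congr fun i => hfM i x

variable (A B) in
theorem empty_mem_baseCFLMV : (fun _ => ∅) ∈ baseCFLMV A B := by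
  simpa only [Set.iUnion_of_empty] using
    iUnion_mem_baseCFLMV (ι := Empty) (A := A) (B := B) (f := Empty.elim) fun i => i.elim

theorem baseCFLMV_vee_subset : baseCFLMV.vee baseCFLMV ⊆ baseCFLMV := by
  rintro A B _ _ _ _ f ⟨f₁, h₁, f₂, h₂, h⟩
  obtain rfl : f = fun x => ⋃ b : Bool, cond b (f₁ x) (f₂ x) :=
    funext fun x => (h x).trans Set.union_eq_iUnion
  exact iUnion_mem_baseCFLMV (f := fun b x => cond b (f₁ x) (f₂ x)) (Bool.rec h₂ h₁)

theorem countEq_mem_baseCFLSV [DecidableEq A] (a b : A) :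
    (fun x => {y | x.count a = x.count b ∧ y = []}) ∈ baseCFLSV A B := by
  let diff (c : A) : ℤ := (if c = a then 1 else 0) - if c = b then 1 else 0
  let ω (c : A) : SignType := SignType.sign (diff c)
  have coe_ω (c : A) : (ω c : ℤ) = diff c := by
    unfold ω diff
    split_ifs <;> rfl
  have sum_ω (x : List A) : (x.map fun c => (ω c : ℤ)).sum = x.count a - x.count b := by
    induction x with
    | nil => rfl
    | cons c x ih =>
      rw [List.map_cons, List.sum_cons, ih, coe_ω]
      simp only [diff, List.count_cons, beq_iff_eq]
      push_cast
      ring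
  refine ⟨⟨.zeroSum ω, NPDA.zeroSum_terminating, fun x => ?_⟩, ?_⟩
  · simp only [NPDA.validOutputs_zeroSum, sum_ω, sub_eq_zero, Nat.cast_inj]
  · rintro x y ⟨-, rfl⟩ z ⟨-, rfl⟩
    rfl

end Base

/-- The function that separates the levels of the hierarchy of single-valued functions: on the
words over an alphabet with two halves of `m` letters it is defined, with the empty string as
value, if corresponding letters of the two halves occur equally often. -/
def balance (m : ℕ) (x : List (Fin (m + m))) : Set (List Unit) :=
  {y | (fun a => x.count a) ∈ diagonal m ∧ y = []}

theorem nil_mem_balance_sortedWord_iff {m : ℕ} {v : Fin (m + m) → ℕ} :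
    [] ∈ balance m (sortedWord v) ↔ v ∈ diagonal m := by
  simp only [balance, Set.mem_ofPred_eq, count_sortedWord, and_true]

theorem balance_mem_CFLSV (k : ℕ) : balance (k + 1) ∈ CFLSV (k + 1) _ _ := by
  refine FunClass.mem_conj_succ.2 ⟨_, fun i => countEq_mem_baseCFLSV
    (Fin.castAdd (k + 1) i) (Fin.natAdd (k + 1) i), fun x => ?_⟩
  ext y
  simp only [balance, diagonal, Set.mem_ofPred_eq, Set.mem_iInter, forall_and, forall_const]

theorem balance_notMem_CFLSV {k : ℕ} (hk : 1 ≤ k) : balance (k + 1) ∉ CFLSV k _ _ := by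
  intro h
  obtain ⟨g, hg, hbalance⟩ := (FunClass.mem_conj_iff_fin hk).1 h
  choose M _ hM using fun j => (hg j).1
  have : Nonempty (Fin k) := ⟨⟨0, hk⟩⟩
  refine iInter_ne_diagonal (J := Fin k) (m := k + 1) (by simp)
    (fun j => (M j).isStratifiedSemilinearSet) (Set.ext fun v => ?_)
  rw [← nil_mem_balance_sortedWord_iff, hbalance]
  simp only [hM, Set.mem_iInter, Set.mem_ofPred_eq]

theorem mainTheorem7 (k m : ℕ) (hk : 1 ≤ k) (hm : 1 ≤ m) :
    (CFLMV (max k m) ⊆ (CFLMV k).vee (CFLMV m) ∧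
      (CFLMV k).vee (CFLMV m) ⊆ CFLMV (k * m)) ∧
    (CFLMV (max k m) ⊆ (CFLMV k).wedge (CFLMV m) ∧
      (CFLMV k).wedge (CFLMV m) ⊆ CFLMV (k + m)) ∧
    CFLSV k ⊂ CFLSV (k + 1) := by
  refine ⟨⟨FunClass.conj_max_subset_vee empty_mem_baseCFLMV hk hm,
    FunClass.conj_vee_subset baseCFLMV_vee_subset hk hm⟩,
    ⟨FunClass.conj_max_subset_wedge hk hm, FunClass.conj_wedge_subset hk hm⟩,
    FunClass.conj_subset_conj_succ hk, ?_⟩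
  exact ⟨_, _, inferInstance, inferInstance, inferInstance, inferInstance, balance (k + 1),
    balance_mem_CFLSV k, balance_notMem_CFLSV hk⟩
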